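/- Let $A\in\mathbb R^{n\times n}$, $B\in\mathbb R^{n\times m}$, $C\in\mathbb R^{m\times n}$, $D\in\mathbb R^{m\times m}$ with spectral norm $\|D\|<1$. For $J\subseteq\{1,\dots,m\}$ let $F_J\in\mathbb R^{m\times m}$ be the matrix whose $J\times J$ block is $(I-D_{J\times J})^{-1}$ and whose other entries are $0$, and let $\Lambda_J$ be the set of complex eigenvalues of $A+BF_JC$. For $\mu\in\Lambda_J$, a unit eigenvector is a pair $(v,F_JCv)$ with $v\in\mathbb C^n$, $(A+BF_JC)v=\mu v$ and $\sum_i v_i^2+\sum_j (F_JCv)_j^2=1$ (no conjugation). Assume that $(A,B,C,D)$ is generic: (1) for every $J$, $\Lambda_J$ consists of $n$ distinct nonzero eigenvalues, each having exactly two unit eigenvectors; (2) $\bigcup_J\Lambda_J$ has $n2^m$ elements; (3) the set of all unit eigenvectors, for all $J$ and $\mu \in \Lambda_J$, has $2n2^m$ elements, all with nonzero first coordinate $v_1$. In $\mathbb R[x,w,\lambda]$, with $x=(x_1,\dots,x_n)$ and $w=(w_1,\dots,w_m)$, put $\|(x,w)\|^2=\sum_i x_i^2+\sum_j w_j^2$,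 $e_i=(Ax+Bw-\lambda x)_i$ for $1\le i\le n$, $e_{n+j}=w_j(Cx+Dw)_j-w_j^2$ for $1\le j\le m$, and $$G=\{\,w_iw_j,\ w_jw_i-w_j(Cx+Dw)_i,\ [w_i-(Cx+Dw)_i][w_j-(Cx+Dw)_j]\ :\ 1\le i,j\le m\,\}.$$ Let $S\subset\mathbb R^{n+m+1}$ be the set of real $(x,w,\lambda)$ with $e_1=\dots=e_{n+m}=0$, $\|(x,w)\|^2=1$, $\lambda\ge 0$ and $g\ge0$ for all $g\in G$. Let $\mathcal B_N^-=\{\lambda^kx_i,\lambda^kw_j: 0\le k\le N\}$, and let $\mathbb R[x,w,\lambda]_{=\ell}$ be the set of polynomials homogeneous of degree $\ell$ in $(x,w)$ (with any powers of $\lambda$). For a real sequence $y=(y_\alpha)$ indexed by the monomials let $L_y(\sum_\alpha p_\alpha z^\alpha)=\sum_\alpha p_\alpha y_\alpha$, where $z=(x,w,\lambda)$. Let $f\in\mathbb R[x,w,\lambda]_{=2}$ and $f^{\min}=\inf_S f$ (equal to $+\infty$ if $S=\emptyset$). For $d\ge2$, $N\ge1$ let $\tilde H_{d,N}(y)$ be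 the matrix indexed by $\mathcal B_N^-$ with entries $L_y(\|(x,w)\|^{2d-2}bb')$. The moment relaxation of order $(d,N)$ is $$\tilde f^{\rm mom}_{d,N}=\inf_y L_y(\|(x,w)\|^{2d-2}f)$$ over all $y$ such that - $\tilde H_{d,N}(y)\succeq0$, - $\big(L_y(\|(x,w)\|^{2d-2}\lambda bb')\big)_{b,b'\in\mathcal B_{N-1}^-}\succeq0$, - $\big(L_y(\|(x,w)\|^{2d-4}g\,bb')\big)_{b,b'\in\mathcal B_N^-}\succeq0$ for all $g\in G$, - $L_y(pe_i)=0$ for $1\le i\le n$ and all $p\in\mathbb R[x,w,\lambda]_{=2d-1}$ with $\deg p\le 2N+2d-1$, - $L_y(qe_{n+j})=0$ for $1\le j\le m$ and all $q\in\mathbb R[x,w,\lambda]_{=2d-2}$ with $\deg q\le2N+2d-2$, - $L_y(\|(x,w)\|^{2d})=1$. The sum of squares program of order $(d,N)$ is $\tilde f^{\rm sos}_{d,N}=\sup\rho$ over all $\rho\in\mathbb R$ for which there is an identity $$\|(x,w)\|^{2d-2}(f-\rho\|(x,w)\|^2)=\|(x,w)\|^{2d-2}\Big(\sum_\ell v_{0,\ell}^2+\lambda\sum_\ell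 v_{\lambda,\ell}^2\Big)+\|(x,w)\|^{2d-4}\sum_{g\in G}g\sum_\ell v_{g,\ell}^2+\sum_{i=1}^np_ie_i+\sum_{j=1}^mq_je_{n+j}$$ with finite sums, $v_{0,\ell},v_{g,\ell}$ supported on $\mathcal B_N^-$, $v_{\lambda,\ell}$ supported on $\mathcal B_{N-1}^-$, $p_i\in\mathbb R[x,w,\lambda]_{=2d-1}$ with $\deg p_i\le2N+2d-1$, and $q_j\in\mathbb R[x,w,\lambda]_{=2d-2}$ with $\deg q_j\le2N+2d-2$. As usual, $\inf\emptyset=+\infty$ and $\sup\emptyset=-\infty$. Then: (i) the hierarchy converges in finitely many steps: there are $d_0,N_0$ such that $\tilde f^{\rm mom}_{d,N}=\tilde f^{\rm sos}_{d,N}=f^{\min}$ for all $d\ge d_0$, $N\ge N_0$; (ii) there are $d_0,N_0$ such that for all $d\ge d_0$, $N\ge N_0$ there is an integer $s$ with $1\le s\le N$ such that $\operatorname{rank}\tilde H_{d,s}(y)=\operatorname{rank}\tilde H_{d,s-1}(y)$ for every feasible (in particular every optimal) $y$ of the moment relaxation of order $(d,N)$. -/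

import Mathlib

namespace SparseHierarchy

open MvPolynomial

noncomputable section

/-- The variables: `Sum.inl (Sum.inl i)` is `x_i`, `Sum.inl (Sum.inr j)` is `w_j`,
and `Sum.inr ()` is `λ`. -/
abbrev Var (n m : ℕ) : Type := (Fin n ⊕ Fin m) ⊕ Unit

/-- The polynomial ring `ℝ[x, w, λ]`. -/
abbrev XWPoly (n m : ℕ) : Type := MvPolynomial (Var n m) ℝ

section Polynomials

variable {n m : ℕ}

/-- The coordinate `x_i`. -/
def xP (i : Fin n) : XWPoly n m := X (Sum.inl (Sum.inl i))

/-- The coordinate `w_j`. -/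
def wP (j : Fin m) : XWPoly n m := X (Sum.inl (Sum.inr j))

/-- The coordinate `λ`. -/
def lamP : XWPoly n m := X (Sum.inr ())

/-- The polynomial `‖(x, w)‖² = ∑ x_i² + ∑ w_j²`. -/
def normSqP : XWPoly n m := ∑ i, xP i ^ 2 + ∑ j, wP j ^ 2

/-- The polynomial `(C x + D w)_j`. -/
def affP (C : Matrix (Fin m) (Fin n) ℝ) (D : Matrix (Fin m) (Fin m) ℝ) (j : Fin m) : XWPoly n m :=
  ∑ i, MvPolynomial.C (C j i) * xP i + ∑ k, MvPolynomial.C (D j k) * wP k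

/-- `e_i = (A x + B w - λ x)_i`, for `i = 1, …, n`. -/
def eigEq (A : Matrix (Fin n) (Fin n) ℝ) (B : Matrix (Fin n) (Fin m) ℝ) (i : Fin n) : XWPoly n m :=
  (∑ k, MvPolynomial.C (A i k) * xP k + ∑ j, MvPolynomial.C (B i j) * wP j) - lamP * xP i

/-- `e_{n+j} = w_j (C x + D w)_j - w_j²`, for `j = 1, …, m`. -/
def reluEq (C : Matrix (Fin m) (Fin n) ℝ) (D : Matrix (Fin m) (Fin m) ℝ) (j : Fin m) : XWPoly n m :=
  wP j * affP C D j - wP j ^ 2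

open Classical in
/-- The finite set `G` of quadratic inequality constraints: all
`w_i w_j`, `w_j w_i - w_j (C x + D w)_i` and `[w_i - (C x + D w)_i] [w_j - (C x + D w)_j]`. -/
def ineqSet (C : Matrix (Fin m) (Fin n) ℝ) (D : Matrix (Fin m) (Fin m) ℝ) : Finset (XWPoly n m) :=
  (Finset.univ.image fun p : Fin m × Fin m => wP p.1 * wP p.2) ∪
  (Finset.univ.image fun p : Fin m × Fin m => wP p.2 * wP p.1 - wP p.2 * affP C D p.1) ∪
  (Finset.univ.image fun p : Fin m × Fin m => (wP p.1 - affP C D p.1) * (wP p.2 - affP C D p.2))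

/-- The semialgebraic set `S` of all real `(x, w, λ)` such that `A x + B w = λ x`,
`w ⊙ (C x + D w - w) = 0`, `‖x‖² + ‖w‖² = 1`, `λ ≥ 0` and `g ≥ 0` for all `g ∈ G`. -/
def feasSet (A : Matrix (Fin n) (Fin n) ℝ) (B : Matrix (Fin n) (Fin m) ℝ)
    (C : Matrix (Fin m) (Fin n) ℝ) (D : Matrix (Fin m) (Fin m) ℝ) : Set (Var n m → ℝ) :=
  {a | (∀ i, eval a (eigEq A B i) = 0) ∧ (∀ j, eval a (reluEq C D j) = 0) ∧
    eval a (normSqP : XWPoly n m) - 1 = 0 ∧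
    0 ≤ eval a (lamP : XWPoly n m) ∧ ∀ g ∈ ineqSet C D, 0 ≤ eval a g}

/-- The infimum of `f` over `S` in the extended reals. -/
def minValue (A : Matrix (Fin n) (Fin n) ℝ) (B : Matrix (Fin n) (Fin m) ℝ)
    (C : Matrix (Fin m) (Fin n) ℝ) (D : Matrix (Fin m) (Fin m) ℝ) (f : XWPoly n m) : EReal :=
  sInf {r : EReal | ∃ a ∈ feasSet A B C D, r = ((eval a f : ℝ) : EReal)}

/-- The weights giving the degree in `(x, w)`: `1` on `x_i` and `w_j`, and `0` on `λ`. -/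
def xwWeight : Var n m → ℕ := Sum.elim (fun _ => 1) (fun _ => 0)

/-- `p ∈ ℝ[x, w, λ]_{=ℓ}`: `p` is homogeneous of degree `ℓ` in `(x, w)`. -/
def IsXWHomogeneous (p : XWPoly n m) (ℓ : ℕ) : Prop := IsWeightedHomogeneous xwWeight p ℓ

/-- Index set of `B_N⁻ = {λ^k x_i, λ^k w_j : 0 ≤ k ≤ N}`. -/
abbrev BIdx (n m N : ℕ) : Type := Fin (N + 1) × (Fin n ⊕ Fin m)

/-- The monomials of `B_N⁻`. -/
def bMon {N : ℕ} (b : BIdx n m N) : XWPoly n m := lamP ^ (b.1 : ℕ) * X (Sum.inl b.2)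

/-- `σ` is a finite sum of squares of polynomials that are supported on `B_N⁻`. -/
def IsSosOn (N : ℕ) (σ : XWPoly n m) : Prop :=
  ∃ (k : ℕ) (v : Fin k → XWPoly n m),
    (∀ ℓ, v ℓ ∈ Submodule.span ℝ (Set.range (bMon (n := n) (m := m) (N := N)))) ∧
      σ = ∑ ℓ, v ℓ ^ 2

/-- The linear functional `L_y(p) = ∑_α p_α y_α`. -/
def rieszL (y : (Var n m →₀ ℕ) → ℝ) (p : XWPoly n m) : ℝ := ∑ α ∈ p.support, p.coeff α * y α

/-- The matrix indexed by `B_N⁻` with entries `L_y(‖(x, w)‖^{2k} h b b')`. -/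
def locMatrix (y : (Var n m →₀ ℕ) → ℝ) (h : XWPoly n m) (k N : ℕ) :
    Matrix (BIdx n m N) (BIdx n m N) ℝ :=
  Matrix.of fun b b' => rieszL y (normSqP ^ k * h * bMon b * bMon b')

/-- The Hankel matrix `H̃_{d,N}(y)` of the relaxation of order `(d, N)`, with entries
`L_y(‖(x, w)‖^{2d-2} b b')` for `b, b' ∈ B_N⁻`. These are pseudo-moments of degree `2d` in
`(x, w)`, and positive semidefiniteness is dual to the term `‖(x, w)‖^{2d-2} ∑ v_{0,ℓ}²`
of the sum of squares program. -/
def hankel (y : (Var n m →₀ ℕ) → ℝ) (d N : ℕ) : Matrix (BIdx n m N) (BIdx n m N) ℝ :=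
  locMatrix y 1 (d - 1) N

/-- Feasibility of `y` for the sparse homogenized moment relaxation of order `(d, N)`
(meant for `d ≥ 2`, `N ≥ 1`). -/
structure MomFeasible (A : Matrix (Fin n) (Fin n) ℝ) (B : Matrix (Fin n) (Fin m) ℝ)
    (C : Matrix (Fin m) (Fin n) ℝ) (D : Matrix (Fin m) (Fin m) ℝ) (d N : ℕ)
    (y : (Var n m →₀ ℕ) → ℝ) : Prop where
  hankel_psd : (hankel y d N).PosSemidef
  lam_psd : (locMatrix y lamP (d - 1) (N - 1)).PosSemidef
  ineq_psd : ∀ g ∈ ineqSet C D, (locMatrix y g (d - 2) N).PosSemidef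
  eig_eq : ∀ p : XWPoly n m, IsXWHomogeneous p (2 * d - 1) → p.totalDegree ≤ 2 * N + 2 * d - 1 →
    ∀ i, rieszL y (p * eigEq A B i) = 0
  relu_eq : ∀ q : XWPoly n m, IsXWHomogeneous q (2 * d - 2) → q.totalDegree ≤ 2 * N + 2 * d - 2 →
    ∀ j, rieszL y (q * reluEq C D j) = 0
  norm_eq : rieszL y (normSqP ^ d) = 1

/-- The optimal value of the moment relaxation of order `(d, N)` (`+∞` if it is infeasible). -/
def momValue (A : Matrix (Fin n) (Fin n) ℝ) (B : Matrix (Fin n) (Fin m) ℝ)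
    (C : Matrix (Fin m) (Fin n) ℝ) (D : Matrix (Fin m) (Fin m) ℝ) (f : XWPoly n m) (d N : ℕ) :
    EReal :=
  sInf {r : EReal | ∃ y, MomFeasible A B C D d N y ∧
    r = ((rieszL y (normSqP ^ (d - 1) * f) : ℝ) : EReal)}

/-- Feasibility of `ρ` for the sparse homogenized sum of squares program of order `(d, N)`
(meant for `d ≥ 2`, `N ≥ 1`). -/
def SosFeasible (A : Matrix (Fin n) (Fin n) ℝ) (B : Matrix (Fin n) (Fin m) ℝ)
    (C : Matrix (Fin m) (Fin n) ℝ) (D : Matrix (Fin m) (Fin m) ℝ) (f : XWPoly n m) (d N : ℕ)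
    (ρ : ℝ) : Prop :=
  ∃ (σ₀ σlam : XWPoly n m) (σ : XWPoly n m → XWPoly n m) (p : Fin n → XWPoly n m) (q : Fin m → XWPoly n m),
    IsSosOn N σ₀ ∧ IsSosOn (N - 1) σlam ∧ (∀ g ∈ ineqSet C D, IsSosOn N (σ g)) ∧
    (∀ i, IsXWHomogeneous (p i) (2 * d - 1) ∧ (p i).totalDegree ≤ 2 * N + 2 * d - 1) ∧
    (∀ j, IsXWHomogeneous (q j) (2 * d - 2) ∧ (q j).totalDegree ≤ 2 * N + 2 * d - 2) ∧
    normSqP ^ (d - 1) * (f - MvPolynomial.C ρ * normSqP) =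
      normSqP ^ (d - 1) * (σ₀ + lamP * σlam) +
      normSqP ^ (d - 2) * ∑ g ∈ ineqSet C D, g * σ g +
      ∑ i, p i * eigEq A B i + ∑ j, q j * reluEq C D j

/-- The optimal value of the sum of squares program of order `(d, N)`. -/
def sosValue (A : Matrix (Fin n) (Fin n) ℝ) (B : Matrix (Fin n) (Fin m) ℝ)
    (C : Matrix (Fin m) (Fin n) ℝ) (D : Matrix (Fin m) (Fin m) ℝ) (f : XWPoly n m) (d N : ℕ) :
    EReal :=
  sSup {r : EReal | ∃ ρ : ℝ, SosFeasible A B C D f d N ρ ∧ r = (ρ : EReal)}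

end Polynomials

section Generic

variable {n m : ℕ}

/-- `F_J`: the block with rows and columns in `J` is `(I - D_{J × J})⁻¹`, all other entries
are zero. -/
def blockInv (D : Matrix (Fin m) (Fin m) ℝ) (J : Finset (Fin m)) : Matrix (Fin m) (Fin m) ℝ :=
  Matrix.of fun i j =>
    if h : i ∈ J ∧ j ∈ J then
      (1 - D.submatrix (Subtype.val : J → Fin m) (Subtype.val : J → Fin m))⁻¹ ⟨i, h.1⟩ ⟨j, h.2⟩
    else 0

/-- `A + B F_J C` as a complex matrix. -/
def modeMatrix (A : Matrix (Fin n) (Fin n) ℝ) (B : Matrix (Fin n) (Fin m) ℝ)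
    (C : Matrix (Fin m) (Fin n) ℝ) (D : Matrix (Fin m) (Fin m) ℝ) (J : Finset (Fin m)) :
    Matrix (Fin n) (Fin n) ℂ :=
  (A + B * blockInv D J * C).map Complex.ofReal

/-- `F_J C` as a complex matrix. -/
def liftMatrix (C : Matrix (Fin m) (Fin n) ℝ) (D : Matrix (Fin m) (Fin m) ℝ) (J : Finset (Fin m)) :
    Matrix (Fin m) (Fin n) ℂ :=
  (blockInv D J * C).map Complex.ofReal

/-- `Λ_J`: the complex eigenvalues of `A + B F_J C`. -/
def modeEigs (A : Matrix (Fin n) (Fin n) ℝ) (B : Matrix (Fin n) (Fin m) ℝ)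
    (C : Matrix (Fin m) (Fin n) ℝ) (D : Matrix (Fin m) (Fin m) ℝ) (J : Finset (Fin m)) : Set ℂ :=
  {μ | Module.End.HasEigenvalue (Matrix.toLin' (modeMatrix A B C D J)) μ}

/-- The points `(v, F_J C v) ∈ ℂ^n × ℂ^m`, for `v` an eigenvector of `A + B F_J C` with
eigenvalue `μ`, that are of unit length: `∑ v_i² + ∑ (F_J C v)_j² = 1` (no conjugation). -/
def unitEigvecs (A : Matrix (Fin n) (Fin n) ℝ) (B : Matrix (Fin n) (Fin m) ℝ)
    (C : Matrix (Fin m) (Fin n) ℝ) (D : Matrix (Fin m) (Fin m) ℝ) (J : Finset (Fin m)) (μ : ℂ) :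
    Set ((Fin n → ℂ) × (Fin m → ℂ)) :=
  {z | Matrix.mulVec (modeMatrix A B C D J) z.1 = μ • z.1 ∧
    z.2 = Matrix.mulVec (liftMatrix C D J) z.1 ∧ ∑ i, z.1 i ^ 2 + ∑ j, z.2 j ^ 2 = 1}

/-- Genericity of the matrix tuple `(A, B, C, D)`. -/
structure IsGeneric (A : Matrix (Fin n) (Fin n) ℝ) (B : Matrix (Fin n) (Fin m) ℝ)
    (C : Matrix (Fin m) (Fin n) ℝ) (D : Matrix (Fin m) (Fin m) ℝ) : Prop where
  eigs_card : ∀ J, (modeEigs A B C D J).ncard = n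
  eigs_ne_zero : ∀ J, ∀ μ ∈ modeEigs A B C D J, μ ≠ 0
  unit_card : ∀ J, ∀ μ ∈ modeEigs A B C D J, (unitEigvecs A B C D J μ).ncard = 2
  all_eigs_card : (⋃ J, modeEigs A B C D J).ncard = n * 2 ^ m
  all_unit_card : (⋃ J, ⋃ μ, unitEigvecs A B C D J μ).ncard = 2 * (n * 2 ^ m)
  first_coord_ne_zero : ∀ J μ, ∀ z ∈ unitEigvecs A B C D J μ, ∀ i : Fin n, (i : ℕ) = 0 → z.1 i ≠ 0

end Generic

end

end SparseHierarchy

open SparseHierarchy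

/-!
The equations `e_1 = … = e_{n+m} = 0` define finitely many complex lines in `(x, w)`: if `J` is
the set of active indices, then `w = F_J C x` and `(A + B F_J C) x = λ x` (`eq_actVec_blockInv`,
`mode_relations`), and by genericity the `n 2^m` eigenvalues that occur are distinct, with
eigenvectors that can be scaled to `x_1 = 1`. Their coordinates are values `r_u(λ)` of real
polynomials at the eigenvalues (`IsEigCurve`), so that polynomials `P(λ) x_1` with `P` of degree
less than the number of eigenvalues take at these points all values that are compatible with
complex conjugation (`IsEigCurve.exists_mem_span_evalCurve_eq`).

The algebraic core is `exists_forall_eq_sum_mul_eqs`: for large `d` and `N`, a form of degree `2d`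
in `(x, w)` and of degree at most `2N` in `λ` that vanishes at all these points is a combination
of the `e_i` with cofactors of the degrees allowed in the relaxations. For each `J` let
`g_J = ∏_{j ∈ J} w_j ∏_{j ∉ J} (w_j - (C x + D w)_j)`. A prime ideal containing all equations and all
`g_J` contains the equations of two activation patterns at once, hence two coprime characteristic
polynomials in `λ` times each `x_i`, hence all `x_i` and `w_j` (`span_X_le_radical`). So every
form `h` of high degree is `∑ a_J g_J` modulo the equations. If `h` vanishes at the points, then
`a_J` vanishes at those of the pattern `J`, which puts it into the ideal of this pattern
(`mem_modeIdeal`), and `g_J` multiplies that ideal into the ideal of the equations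
(`sepP_mul_mem`). The degrees in `λ` are controlled in two steps. Since `D` is a contraction,
every form of high degree is a combination of the `x_i` modulo the equations `e_{n+j}`, and
`λ x_i` can be replaced by `(A x + B w)_i`, so a form is congruent to one without `λ`
(`exists_sub_rename_mem_truncIdeal`). For forms without `λ` the ascending chain condition in
`ℝ[x, w]` gives one bound for all cofactors (`exists_mem_truncIdeal_of_mem_eqIdeal`).

Consequently a certificate for a lower bound `ρ` only has to have the right values at finitely
many points, and these are attained by interpolated squares (`exists_forall_sosFeasible`). With
weak duality and point evaluations this gives equality of the three values. Likewise a feasible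
`y` only sees values at the points, so the columns of the Hankel matrix indexed by high powers of
`λ` are combinations of those indexed by `λ^k x_1` with `k` less than the number of eigenvalues,
which bounds the rank (`rank_hankel_le`).
-/

namespace SparseHierarchy

open MvPolynomial

noncomputable section

variable {n m : ℕ}

/-! ### The activation pattern of a point -/

/-- A principal submatrix of a contraction is a contraction, so `I - D_{J × J}` is invertible. -/
theorem isUnit_det_one_sub_submatrix {D : Matrix (Fin m) (Fin m) ℝ}
    (hD : ‖Matrix.toEuclideanCLM (n := Fin m) (𝕜 := ℝ) D‖ < 1) (J : Finset (Fin m)) :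
    IsUnit (1 - D.submatrix (Subtype.val : J → Fin m) (Subtype.val : J → Fin m)).det := by
  rw [isUnit_iff_ne_zero]
  intro h0
  obtain ⟨v, hv, hv0⟩ := Matrix.exists_mulVec_eq_zero_iff.mpr h0
  have hfix : ∀ j : J, v j = ∑ k : J, D j k * v k := by
    intro j
    have := congrFun hv0 j
    rw [Matrix.sub_mulVec, Matrix.one_mulVec] at this
    simpa [Matrix.mulVec, dotProduct, sub_eq_zero] using this
  -- extension of `v` by zero
  let u : EuclideanSpace ℝ (Fin m) := WithLp.toLp 2 fun j => if h : j ∈ J then v ⟨j, h⟩ else 0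
  have hsum : ∀ g : Fin m → ℝ, ∑ k, g k * u k = ∑ k : J, g k * v k := by
    intro g
    rw [← Finset.sum_subset (Finset.subset_univ J), ← Finset.sum_coe_sort J]
    · exact Finset.sum_congr rfl fun k _ => by simp [u]
    · intro k _ hk
      simp [u, hk]
  have hle : ‖u‖ ≤ ‖Matrix.toEuclideanCLM (n := Fin m) (𝕜 := ℝ) D u‖ := by
    rw [EuclideanSpace.norm_eq, EuclideanSpace.norm_eq]
    refine Real.sqrt_le_sqrt (Finset.sum_le_sum fun j _ => ?_)
    by_cases hj : j ∈ J
    · refine le_of_eq ?_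
      congr 2
      have h1 : (Matrix.toEuclideanCLM (n := Fin m) (𝕜 := ℝ) D u) j = ∑ k, D j k * u k := by
        simp [Matrix.mulVec, dotProduct]
      rw [h1, hsum, ← hfix ⟨j, hj⟩]
      simp [u, hj]
    · have : u j = 0 := by simp [u, hj]
      rw [this]
      simpa using sq_nonneg _
  have hu : u ≠ 0 := by
    intro h
    apply hv
    funext j
    have := congrArg (fun z : EuclideanSpace ℝ (Fin m) => z j) h
    simpa [u] using this
  have hpos : 0 < ‖u‖ := norm_pos_iff.mpr hu
  have := hle.trans ((Matrix.toEuclideanCLM (n := Fin m) (𝕜 := ℝ) D).le_opNorm u)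
  nlinarith

/-- The coordinate projection onto the indices in `J`. -/
def indicatorMatrix (J : Finset (Fin m)) : Matrix (Fin m) (Fin m) ℝ :=
  Matrix.diagonal fun j => if j ∈ J then 1 else 0

theorem indicatorMatrix_mul_blockInv (D : Matrix (Fin m) (Fin m) ℝ) (J : Finset (Fin m)) :
    indicatorMatrix J * blockInv D J = blockInv D J := by
  ext i k
  by_cases hi : i ∈ J <;> simp [indicatorMatrix, blockInv, hi]

theorem blockInv_mul_indicatorMatrix (D : Matrix (Fin m) (Fin m) ℝ) (J : Finset (Fin m)) :
    blockInv D J * indicatorMatrix J = blockInv D J := by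
  ext i k
  by_cases hi : k ∈ J <;> simp [indicatorMatrix, blockInv, hi]

theorem blockInv_mul_one_sub {D : Matrix (Fin m) (Fin m) ℝ}
    (hD : ‖Matrix.toEuclideanCLM (n := Fin m) (𝕜 := ℝ) D‖ < 1) (J : Finset (Fin m)) :
    blockInv D J * (1 - D) * indicatorMatrix J = indicatorMatrix J := by
  ext i k
  rw [indicatorMatrix, Matrix.mul_diagonal, Matrix.mul_apply,
    ← Finset.sum_subset (Finset.subset_univ J)
      (fun a _ ha => by simp [blockInv, ha]), ← Finset.sum_coe_sort J]
  by_cases hi : i ∈ J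
  · by_cases hk : k ∈ J
    · have := congrFun (congrFun (Matrix.nonsing_inv_mul _ (isUnit_det_one_sub_submatrix hD J))
        ⟨i, hi⟩) ⟨k, hk⟩
      rw [Matrix.mul_apply] at this
      simp only [hk, if_true, mul_one]
      convert this using 1
      · refine Finset.sum_congr rfl fun a _ => ?_
        simp [blockInv, hi, Matrix.one_apply, Subtype.ext_iff]
      · simp [Matrix.diagonal_apply, Matrix.one_apply, hi]
    · have : i ≠ k := fun h => hk (h ▸ hi)
      simp [hk, this]
  · simp [blockInv, hi, Matrix.diagonal_apply]

theorem one_sub_mul_blockInv {D : Matrix (Fin m) (Fin m) ℝ}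
    (hD : ‖Matrix.toEuclideanCLM (n := Fin m) (𝕜 := ℝ) D‖ < 1) (J : Finset (Fin m)) :
    indicatorMatrix J * (1 - D) * blockInv D J = indicatorMatrix J := by
  ext i k
  rw [indicatorMatrix, Matrix.mul_apply,
    ← Finset.sum_subset (Finset.subset_univ J)
      (fun a _ ha => by simp [blockInv, ha]), ← Finset.sum_coe_sort J]
  by_cases hi : i ∈ J
  · by_cases hk : k ∈ J
    · have := congrFun (congrFun (Matrix.mul_nonsing_inv _ (isUnit_det_one_sub_submatrix hD J))
        ⟨i, hi⟩) ⟨k, hk⟩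
      rw [Matrix.mul_apply] at this
      convert this using 1
      · refine Finset.sum_congr rfl fun a _ => ?_
        simp [blockInv, hi, hk, Matrix.one_apply, Subtype.ext_iff]
      · simp [Matrix.diagonal_apply, Matrix.one_apply, hi]
    · have : i ≠ k := fun h => hk (h ▸ hi)
      simp [hk, this, blockInv]
  · simp [hi, Matrix.diagonal_apply]

section Relations

variable {Q : Type*} [CommRing Q] [Algebra ℝ Q]

/-- A real matrix acting on vectors over a commutative `ℝ`-algebra. -/
def actVec {k l : ℕ} (N : Matrix (Fin k) (Fin l) ℝ) (X : Fin l → Q) : Fin k → Q :=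
  (N.map (algebraMap ℝ Q)).mulVec X

theorem actVec_apply {k l : ℕ} (N : Matrix (Fin k) (Fin l) ℝ) (X : Fin l → Q) (i : Fin k) :
    actVec N X i = ∑ j, algebraMap ℝ Q (N i j) * X j := by
  simp [actVec, Matrix.mulVec, dotProduct]

theorem actVec_actVec {k l p : ℕ} (M : Matrix (Fin k) (Fin l) ℝ) (N : Matrix (Fin l) (Fin p) ℝ)
    (X : Fin p → Q) : actVec M (actVec N X) = actVec (M * N) X := by
  simp [actVec, Matrix.map_mul]

theorem actVec_add_left {k l : ℕ} (M N : Matrix (Fin k) (Fin l) ℝ)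
    (X : Fin l → Q) : actVec (M + N) X = actVec M X + actVec N X := by
  ext i; simp [actVec_apply, add_mul, Finset.sum_add_distrib]

theorem actVec_sub_left {k l : ℕ} (M N : Matrix (Fin k) (Fin l) ℝ)
    (X : Fin l → Q) : actVec (M - N) X = actVec M X - actVec N X := by
  ext i; simp [actVec_apply, sub_mul, Finset.sum_sub_distrib]

theorem actVec_one {k : ℕ} (X : Fin k → Q) : actVec (1 : Matrix (Fin k) (Fin k) ℝ) X = X := by
  ext i; simp [actVec_apply, Matrix.one_apply, Finset.sum_ite_eq]

theorem actVec_smul {k l : ℕ} (N : Matrix (Fin k) (Fin l) ℝ) (c : Q) (X : Fin l → Q) :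
    actVec N (c • X) = c • actVec N X := by
  simp [actVec, Matrix.mulVec_smul]

theorem actVec_indicatorMatrix (J : Finset (Fin m)) (W : Fin m → Q) (j : Fin m) :
    actVec (indicatorMatrix J) W j = if j ∈ J then W j else 0 := by
  simp [actVec_apply, indicatorMatrix, Matrix.diagonal_apply, apply_ite (algebraMap ℝ Q)]

/-- With activation pattern `J`, the equations `w_j = 0` off `J` and `w_j = (C x + D w)_j` on `J`
force `w = F_J C x`. -/
theorem eq_actVec_blockInv {C : Matrix (Fin m) (Fin n) ℝ} {D : Matrix (Fin m) (Fin m) ℝ}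
    (hD : ‖Matrix.toEuclideanCLM (n := Fin m) (𝕜 := ℝ) D‖ < 1) {J : Finset (Fin m)}
    {X : Fin n → Q} {W : Fin m → Q} (h0 : ∀ j ∉ J, W j = 0)
    (h1 : ∀ j ∈ J, W j = actVec C X j + actVec D W j) : W = actVec (blockInv D J * C) X := by
  have hE : actVec (indicatorMatrix J) W = W := by
    ext j
    by_cases hj : j ∈ J <;> simp [actVec_indicatorMatrix, hj, h0]
  have h2 : actVec (indicatorMatrix J) (actVec (1 - D) W) =
      actVec (indicatorMatrix J) (actVec C X) := by
    ext j
    by_cases hj : j ∈ J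
    · simp only [actVec_indicatorMatrix, hj, if_true, actVec_sub_left, actVec_one, Pi.sub_apply]
      rw [h1 j hj]
      ring
    · simp [actVec_indicatorMatrix, hj]
  calc W = actVec (blockInv D J * (1 - D) * indicatorMatrix J) W := by
        rw [blockInv_mul_one_sub hD, hE]
    _ = actVec (blockInv D J) (actVec (indicatorMatrix J) (actVec (1 - D) W)) := by
        rw [← actVec_actVec, hE, ← actVec_actVec, actVec_actVec (blockInv D J) (indicatorMatrix J),
          blockInv_mul_indicatorMatrix]
    _ = _ := by
        rw [h2, actVec_actVec, blockInv_mul_indicatorMatrix, actVec_actVec]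

/-- Conversely, `w = F_J C x` satisfies `w_j = 0` off `J`. -/
theorem actVec_blockInv_eq_zero (C : Matrix (Fin m) (Fin n) ℝ) (D : Matrix (Fin m) (Fin m) ℝ)
    {J : Finset (Fin m)} (X : Fin n → Q) {j : Fin m} (hj : j ∉ J) :
    actVec (blockInv D J * C) X j = 0 := by
  rw [← indicatorMatrix_mul_blockInv, Matrix.mul_assoc, ← actVec_actVec, actVec_indicatorMatrix,
    if_neg hj]

/-- Conversely, `w = F_J C x` satisfies `w_j = (C x + D w)_j` on `J`. -/
theorem actVec_blockInv_eq {C : Matrix (Fin m) (Fin n) ℝ} {D : Matrix (Fin m) (Fin m) ℝ}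
    (hD : ‖Matrix.toEuclideanCLM (n := Fin m) (𝕜 := ℝ) D‖ < 1) {J : Finset (Fin m)}
    (X : Fin n → Q) {j : Fin m} (hj : j ∈ J) :
    actVec (blockInv D J * C) X j = actVec C X j + actVec D (actVec (blockInv D J * C) X) j := by
  have := congrArg (fun N => actVec (N * C) X j) (one_sub_mul_blockInv hD J)
  simp only [Matrix.mul_assoc] at this
  rw [← actVec_actVec, ← actVec_actVec (indicatorMatrix J), actVec_indicatorMatrix,
    actVec_indicatorMatrix, if_pos hj, if_pos hj, ← actVec_actVec, actVec_sub_left, actVec_one,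
    Pi.sub_apply, sub_eq_iff_eq_add] at this
  exact this

/-- `A + B F_J C` as a real matrix. -/
def modeReal (A : Matrix (Fin n) (Fin n) ℝ) (B : Matrix (Fin n) (Fin m) ℝ)
    (C : Matrix (Fin m) (Fin n) ℝ) (D : Matrix (Fin m) (Fin m) ℝ) (J : Finset (Fin m)) :
    Matrix (Fin n) (Fin n) ℝ :=
  A + B * blockInv D J * C

theorem actVec_modeReal (A : Matrix (Fin n) (Fin n) ℝ) (B : Matrix (Fin n) (Fin m) ℝ)
    (C : Matrix (Fin m) (Fin n) ℝ) (D : Matrix (Fin m) (Fin m) ℝ) (J : Finset (Fin m))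
    (X : Fin n → Q) :
    actVec (modeReal A B C D J) X = actVec A X + actVec B (actVec (blockInv D J * C) X) := by
  rw [modeReal, actVec_add_left, actVec_actVec, Matrix.mul_assoc]

/-- If `M X = t X`, then `P(M) X = P(t) X` for every polynomial `P`. -/
theorem actVec_aeval {M : Matrix (Fin n) (Fin n) ℝ} {X : Fin n → Q} {t : Q}
    (h : actVec M X = t • X) (P : Polynomial ℝ) :
    actVec (Polynomial.aeval M P) X = Polynomial.aeval t P • X := by
  induction P using Polynomial.induction_on' with
  | add p q hp hq => simp [actVec_add_left, hp, hq, add_smul]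
  | monomial k c =>
    have hk : ∀ k : ℕ, actVec (M ^ k) X = t ^ k • X := by
      intro k
      induction k with
      | zero => simp [actVec_one]
      | succ k ih => rw [pow_succ, ← actVec_actVec, h, actVec_smul, ih, smul_smul, pow_succ']
    rw [Polynomial.aeval_monomial, Polynomial.aeval_monomial, mul_smul, ← hk]
    ext i
    simp [actVec_apply, Finset.mul_sum, Algebra.algebraMap_eq_smul_one, smul_smul, mul_comm]

end Relations

/-! ### Ideals of the eigenvalue equations -/

section EqIdeals

variable (A : Matrix (Fin n) (Fin n) ℝ) (B : Matrix (Fin n) (Fin m) ℝ)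
    (C : Matrix (Fin m) (Fin n) ℝ) (D : Matrix (Fin m) (Fin m) ℝ)

/-- The linear form `w_j - (C x + D w)_j`. -/
def slackP (j : Fin m) : XWPoly n m := wP j - affP C D j

/-- The ideal generated by all equations `e_1, …, e_{n+m}`. -/
def eqIdeal : Ideal (XWPoly n m) := Ideal.span (Set.range (eigEq A B) ∪ Set.range (reluEq C D))

/-- The ideal of the activation pattern `J`: `w_j = 0` off `J`, `w_j = (C x + D w)_j` on `J`, and
`A x + B w = λ x`. -/
def modeIdeal (J : Finset (Fin m)) : Ideal (XWPoly n m) :=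
  Ideal.span (Set.range (eigEq A B) ∪ (wP '' {j | j ∉ J} ∪ slackP C D '' {j | j ∈ J}))

/-- The separator of the pattern `J`: the product of the linear forms that do not vanish at the
eigenvectors with pattern `J`. -/
def sepP (J : Finset (Fin m)) : XWPoly n m := (∏ j ∈ J, wP j) * ∏ j ∈ Jᶜ, slackP C D j

theorem slackP_mul_wP (j : Fin m) : slackP C D j * wP j = -reluEq C D j := by
  simp only [slackP, reluEq]
  ring

variable {A B C D}

theorem eigEq_mem_eqIdeal (i : Fin n) : eigEq A B i ∈ eqIdeal A B C D :=
  Ideal.subset_span (Or.inl ⟨i, rfl⟩)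

theorem reluEq_mem_eqIdeal (j : Fin m) : reluEq C D j ∈ eqIdeal A B C D :=
  Ideal.subset_span (Or.inr ⟨j, rfl⟩)

theorem mem_eqIdeal_iff {h : XWPoly n m} : h ∈ eqIdeal A B C D ↔
    ∃ (p : Fin n → XWPoly n m) (q : Fin m → XWPoly n m),
      h = ∑ i, p i * eigEq A B i + ∑ j, q j * reluEq C D j := by
  rw [eqIdeal, Ideal.span_union, Submodule.mem_sup]
  constructor
  · rintro ⟨a, ha, b, hb, rfl⟩
    obtain ⟨p, hp⟩ := (Ideal.mem_span_range_iff_exists_fun).mp ha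
    obtain ⟨q, hq⟩ := (Ideal.mem_span_range_iff_exists_fun).mp hb
    exact ⟨p, q, by rw [hp, hq]⟩
  · rintro ⟨p, q, rfl⟩
    exact ⟨_, Ideal.mem_span_range_iff_exists_fun.mpr ⟨p, rfl⟩, _,
      Ideal.mem_span_range_iff_exists_fun.mpr ⟨q, rfl⟩, rfl⟩

/-- The separator of `J` multiplies the ideal of `J` into the ideal of all equations, because
`w_j (w_j - (C x + D w)_j)` is in the latter. -/
theorem sepP_mul_mem {J : Finset (Fin m)} {a : XWPoly n m} (ha : a ∈ modeIdeal A B C D J) :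
    a * sepP C D J ∈ eqIdeal A B C D := by
  have hle : modeIdeal A B C D J ≤
      Submodule.comap (LinearMap.mulRight (XWPoly n m) (sepP C D J)) (eqIdeal A B C D) := by
    refine Ideal.span_le.mpr ?_
    rintro g (⟨i, rfl⟩ | ⟨j, hj, rfl⟩ | ⟨j, hj, rfl⟩)
    · exact Ideal.mul_mem_right _ _ (eigEq_mem_eqIdeal i)
    · have hj' : j ∈ Jᶜ := by simpa using hj
      change wP j * ((∏ j ∈ J, wP j) * ∏ j ∈ Jᶜ, slackP C D j) ∈ eqIdeal A B C D
      rw [← Finset.mul_prod_erase _ _ hj']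
      have := Ideal.mul_mem_left _ (-((∏ j ∈ J, wP j) * ∏ j ∈ Jᶜ.erase j, slackP C D j))
        (reluEq_mem_eqIdeal (A := A) (B := B) (C := C) (D := D) j)
      convert this using 1
      rw [neg_mul, ← mul_neg, ← slackP_mul_wP]
      ring
    · change slackP C D j * ((∏ j ∈ J, wP j) * ∏ j ∈ Jᶜ, slackP C D j) ∈ eqIdeal A B C D
      rw [← Finset.mul_prod_erase J _ hj]
      have := Ideal.mul_mem_left _ (-((∏ j ∈ J.erase j, wP j) * ∏ j ∈ Jᶜ, slackP C D j))
        (reluEq_mem_eqIdeal (A := A) (B := B) (C := C) (D := D) j)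
      convert this using 1
      rw [neg_mul, ← mul_neg, ← slackP_mul_wP]
      ring
  exact hle ha

section Hom

variable {Q : Type*} [CommRing Q] [Algebra ℝ Q] (ψ : XWPoly n m →ₐ[ℝ] Q)

theorem map_affP (j : Fin m) : ψ (affP C D j) =
    actVec C (fun i => ψ (xP i)) j + actVec D (fun j => ψ (wP j)) j := by
  simp [affP, actVec_apply, ← algebraMap_eq]

theorem map_slackP (j : Fin m) : ψ (slackP C D j) =
    ψ (wP j) - (actVec C (fun i => ψ (xP i)) j + actVec D (fun j => ψ (wP j)) j) := by
  rw [slackP, map_sub, map_affP]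

theorem map_eigEq (i : Fin n) : ψ (eigEq A B i) =
    actVec A (fun i => ψ (xP i)) i + actVec B (fun j => ψ (wP j)) i - ψ lamP * ψ (xP i) := by
  simp [eigEq, actVec_apply, ← algebraMap_eq]

theorem map_reluEq (j : Fin m) : ψ (reluEq C D j) = -(ψ (slackP C D j) * ψ (wP j)) := by
  rw [← map_mul, slackP_mul_wP, map_neg, neg_neg]

/-- Over any commutative `ℝ`-algebra, the equations of the pattern `J` say that `w = F_J C x` and
that `x` is an eigenvector of `A + B F_J C`, if nonzero. -/
theorem mode_relations (hD : ‖Matrix.toEuclideanCLM (n := Fin m) (𝕜 := ℝ) D‖ < 1)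
    {J : Finset (Fin m)} (h0 : ∀ j ∉ J, ψ (wP j) = 0) (h1 : ∀ j ∈ J, ψ (slackP C D j) = 0)
    (h2 : ∀ i, ψ (eigEq A B i) = 0) :
    (fun j => ψ (wP j)) = actVec (blockInv D J * C) (fun i => ψ (xP i)) ∧
      actVec (modeReal A B C D J) (fun i => ψ (xP i)) = ψ lamP • fun i => ψ (xP i) := by
  have hW := eq_actVec_blockInv hD (X := fun i => ψ (xP i)) (W := fun j => ψ (wP j)) h0
    (fun j hj => by simpa [map_slackP, sub_eq_zero] using h1 j hj)
  refine ⟨hW, ?_⟩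
  rw [actVec_modeReal, ← hW]
  ext i
  simpa [map_eigEq, sub_eq_zero] using h2 i

/-- At a point over a domain satisfying the equations and annihilating all separators, two distinct
activation patterns are valid at once. Then `λ` is a common root of two coprime characteristic
polynomials unless `x = 0`. -/
theorem map_X_eq_zero [IsDomain Q] (hD : ‖Matrix.toEuclideanCLM (n := Fin m) (𝕜 := ℝ) D‖ < 1)
    (hcop : ∀ J J', J ≠ J' →
      IsCoprime (modeReal A B C D J).charpoly (modeReal A B C D J').charpoly)
    (he : ∀ i, ψ (eigEq A B i) = 0) (hr : ∀ j, ψ (reluEq C D j) = 0)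
    (hs : ∀ J, ψ (sepP C D J) = 0) (u : Fin n ⊕ Fin m) : ψ (X (Sum.inl u)) = 0 := by
  classical
  have hr' : ∀ j, ψ (slackP C D j) = 0 ∨ ψ (wP j) = 0 := fun j => by
    have := hr j
    rwa [map_reluEq, neg_eq_zero, mul_eq_zero] at this
  let J : Finset (Fin m) := Finset.univ.filter fun j => ψ (wP j) ≠ 0
  have hJ : ∀ j, j ∉ J ↔ ψ (wP j) = 0 := fun j => by simp [J]
  have hJ1 : ∀ j ∈ J, ψ (slackP C D j) = 0 := fun j hj =>
    (hr' j).resolve_right fun h => (hJ j).mpr h hj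
  obtain ⟨j, hj, hj0⟩ : ∃ j ∉ J, ψ (slackP C D j) = 0 := by
    have := hs J
    simp only [sepP, map_mul, map_prod, mul_eq_zero, Finset.prod_eq_zero_iff] at this
    rcases this with ⟨j, hj, h⟩ | ⟨j, hj, h⟩
    · exact absurd hj ((hJ j).mpr h)
    · exact ⟨j, by simpa using hj, h⟩
  have hne : J ≠ insert j J := fun h => hj (h ▸ Finset.mem_insert_self j J)
  obtain ⟨hW, hM⟩ := mode_relations ψ hD (fun j hj => (hJ j).mp hj) hJ1 he
  obtain ⟨-, hM'⟩ := mode_relations (J := insert j J) ψ hD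
    (fun k hk => (hJ k).mp fun h => hk (Finset.mem_insert_of_mem h))
    (fun k hk => (Finset.mem_insert.mp hk).elim (fun h => h ▸ hj0) (hJ1 k)) he
  have hX : (fun i => ψ (xP i)) = 0 := by
    obtain ⟨a, b, hab⟩ := hcop _ _ hne
    have e1 := actVec_aeval hM (modeReal A B C D J).charpoly
    have e2 := actVec_aeval hM' (modeReal A B C D (insert j J)).charpoly
    rw [Matrix.aeval_self_charpoly] at e1 e2
    have := congrArg (fun P => Polynomial.aeval (ψ lamP) P • fun i => ψ (xP i)) hab
    simp only [map_add, map_mul, add_smul, mul_smul, ← e1, ← e2, map_one, one_smul] at this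
    rw [← this]
    ext i
    simp [actVec_apply]
  rw [hX] at hW
  rcases u with i | j
  · exact congrFun hX i
  · refine (congrFun hW j).trans ?_
    simp [actVec_apply]

end Hom

/-- Every `x_i` and `w_j` lies in the radical of the ideal generated by the equations and the
separators. -/
theorem span_X_le_radical (hD : ‖Matrix.toEuclideanCLM (n := Fin m) (𝕜 := ℝ) D‖ < 1)
    (hcop : ∀ J J', J ≠ J' →
      IsCoprime (modeReal A B C D J).charpoly (modeReal A B C D J').charpoly) :
    Ideal.span (Set.range fun u : Fin n ⊕ Fin m => (X (Sum.inl u) : XWPoly n m)) ≤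
      (eqIdeal A B C D ⊔ Ideal.span (Set.range (sepP C D))).radical := by
  rw [Ideal.span_le]
  rintro _ ⟨u, rfl⟩
  rw [SetLike.mem_coe, Ideal.radical_eq_sInf, Submodule.mem_sInf]
  rintro p ⟨hp, hprime⟩
  have hI : eqIdeal A B C D ≤ p := le_sup_left.trans hp
  have hs : Ideal.span (Set.range (sepP C D)) ≤ p := le_sup_right.trans hp
  refine (Ideal.Quotient.eq_zero_iff_mem).mp ?_
  exact map_X_eq_zero (Ideal.Quotient.mkₐ ℝ p) hD hcop
    (fun i => Ideal.Quotient.eq_zero_iff_mem.mpr (hI (eigEq_mem_eqIdeal i)))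
    (fun j => Ideal.Quotient.eq_zero_iff_mem.mpr (hI (reluEq_mem_eqIdeal j)))
    (fun J => Ideal.Quotient.eq_zero_iff_mem.mpr (hs (Ideal.subset_span ⟨J, rfl⟩))) u

/-! ### Forms in `(x, w)` of high degree -/

variable (C D) in
/-- `w_j (C x + D w)_j - w_j²` as an element of `ℝ[x, w]`. -/
def reluForm (j : Fin m) : MvPolynomial (Fin n ⊕ Fin m) ℝ :=
  X (Sum.inr j) * (∑ i, MvPolynomial.C (C j i) * X (Sum.inl i) +
    ∑ k, MvPolynomial.C (D j k) * X (Sum.inr k)) - X (Sum.inr j) ^ 2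

theorem rename_reluForm (j : Fin m) : rename Sum.inl (reluForm C D j) = reluEq C D j := by
  simp [reluForm, reluEq, affP, wP, xP]

/-- On `x = 0` the equations `w_j (D w)_j = w_j²` have only the trivial solution, because `D` is a
contraction. -/
theorem idealOfVars_le_radical (hD : ‖Matrix.toEuclideanCLM (n := Fin m) (𝕜 := ℝ) D‖ < 1) :
    idealOfVars (Fin n ⊕ Fin m) ℝ ≤ (Ideal.span (Set.range (reluForm C D)) ⊔
      Ideal.span (Set.range fun i : Fin n => X (Sum.inl i))).radical := by
  classical
  rw [idealOfVars, Ideal.span_le]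
  rintro _ ⟨u, rfl⟩
  rw [SetLike.mem_coe, Ideal.radical_eq_sInf, Submodule.mem_sInf]
  rintro p ⟨hp, hprime⟩
  let ψ := Ideal.Quotient.mkₐ ℝ p
  have hx : ∀ i, ψ (X (Sum.inl i)) = 0 := fun i => Ideal.Quotient.eq_zero_iff_mem.mpr
    (hp (Ideal.mem_sup_right (Ideal.subset_span ⟨i, rfl⟩)))
  have hr : ∀ j, ψ (reluForm C D j) = 0 := fun j => Ideal.Quotient.eq_zero_iff_mem.mpr
    (hp (Ideal.mem_sup_left (Ideal.subset_span ⟨j, rfl⟩)))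
  let W : Fin m → _ := fun j => ψ (X (Sum.inr j))
  have hW : W = 0 := by
    have := eq_actVec_blockInv (C := C) hD (J := Finset.univ.filter fun j => W j ≠ 0) (W := W)
      (X := fun _ : Fin n => (0 : MvPolynomial (Fin n ⊕ Fin m) ℝ ⧸ p))
      (fun j hj => by simpa using hj)
      (fun j hj => by
        have hj' : W j ≠ 0 := by simpa using hj
        have h1 := hr j
        simp only [reluForm, map_sub, map_mul, map_add, map_sum, hx, mul_zero,
          Finset.sum_const_zero, zero_add, map_pow] at h1
        have h2 : W j * ((∑ k, ψ (MvPolynomial.C (D j k)) * W k) - W j) = 0 := by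
          rw [← h1]; ring
        have h3 := (mul_eq_zero.mp h2).resolve_left hj'
        rw [sub_eq_zero] at h3
        rw [actVec_apply, actVec_apply, ← h3]
        simp [← algebraMap_eq])
    rw [this]
    ext i
    simp [actVec_apply]
  refine (Ideal.Quotient.eq_zero_iff_mem).mp ?_
  rcases u with i | j
  · exact hx i
  · exact congrFun hW j

end EqIdeals

/-! ### Homogeneous cofactors -/

section Graded

variable {σ : Type*} {w : σ → ℕ}

attribute [local instance] MvPolynomial.weightedGradedAlgebra

theorem weightedHomogeneousComponent_mul {g : MvPolynomial σ ℝ} {k : ℕ}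
    (hg : IsWeightedHomogeneous w g k) (a : MvPolynomial σ ℝ) (l : ℕ) :
    weightedHomogeneousComponent w (l + k) (a * g) = weightedHomogeneousComponent w l a * g := by
  have := DirectSum.coe_decompose_mul_add_of_right_mem (weightedHomogeneousSubmodule ℝ w)
    (i := l) (a := a) (b := g) ((mem_weightedHomogeneousSubmodule ℝ w k g).mpr hg)
  simp only [← weightedDecomposition.decompose'_apply]
  exact this

/-- A homogeneous combination of homogeneous polynomials is a combination with homogeneous
cofactors: the components of the original cofactors. -/
theorem eq_sum_weightedHomogeneousComponent_mul {κ : Type*} (s : Finset κ)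
    {a g : κ → MvPolynomial σ ℝ} {δ : κ → ℕ} {l : ℕ}
    (hg : ∀ i ∈ s, IsWeightedHomogeneous w (g i) (δ i)) (hδ : ∀ i ∈ s, δ i ≤ l) :
    weightedHomogeneousComponent w l (∑ i ∈ s, a i * g i) =
      ∑ i ∈ s, weightedHomogeneousComponent w (l - δ i) (a i) * g i := by
  rw [map_sum]
  refine Finset.sum_congr rfl fun i hi => ?_
  rw [← weightedHomogeneousComponent_mul (hg i hi), Nat.sub_add_cancel (hδ i hi)]

theorem degreeOf_weightedHomogeneousComponent_le (p : MvPolynomial σ ℝ) (l : ℕ) (i : σ) :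
    degreeOf i (weightedHomogeneousComponent w l p) ≤ degreeOf i p := by
  rw [degreeOf_eq_sup, degreeOf_eq_sup]
  refine Finset.sup_mono ?_
  rw [support_weightedHomogeneousComponent]
  exact Finset.filter_subset _ _

end Graded

theorem isXWHomogeneous_xP (i : Fin n) : IsXWHomogeneous (xP i : XWPoly n m) 1 :=
  isWeightedHomogeneous_X ℝ xwWeight _

theorem isXWHomogeneous_wP (j : Fin m) : IsXWHomogeneous (wP j : XWPoly n m) 1 :=
  isWeightedHomogeneous_X ℝ xwWeight _

theorem isXWHomogeneous_lamP : IsXWHomogeneous (lamP : XWPoly n m) 0 :=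
  isWeightedHomogeneous_X ℝ xwWeight _

theorem isXWHomogeneous_affP (C : Matrix (Fin m) (Fin n) ℝ) (D : Matrix (Fin m) (Fin m) ℝ)
    (j : Fin m) : IsXWHomogeneous (affP C D j) 1 :=
  (IsWeightedHomogeneous.sum _ _ _ fun i _ => (isXWHomogeneous_xP i).C_mul _).add
    (IsWeightedHomogeneous.sum _ _ _ fun i _ => (isXWHomogeneous_wP i).C_mul _)

theorem isXWHomogeneous_slackP (C : Matrix (Fin m) (Fin n) ℝ) (D : Matrix (Fin m) (Fin m) ℝ)
    (j : Fin m) : IsXWHomogeneous (slackP C D j) 1 :=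
  (isXWHomogeneous_wP j).sub (isXWHomogeneous_affP C D j)

theorem isXWHomogeneous_eigEq (A : Matrix (Fin n) (Fin n) ℝ) (B : Matrix (Fin n) (Fin m) ℝ)
    (i : Fin n) : IsXWHomogeneous (eigEq A B i) 1 :=
  ((IsWeightedHomogeneous.sum _ _ _ fun i _ => (isXWHomogeneous_xP i).C_mul _).add
    (IsWeightedHomogeneous.sum _ _ _ fun i _ => (isXWHomogeneous_wP i).C_mul _)).sub
    (by simpa using! isXWHomogeneous_lamP.mul (isXWHomogeneous_xP i))

theorem isXWHomogeneous_reluEq (C : Matrix (Fin m) (Fin n) ℝ) (D : Matrix (Fin m) (Fin m) ℝ)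
    (j : Fin m) : IsXWHomogeneous (reluEq C D j) 2 :=
  ((isXWHomogeneous_wP j).mul (isXWHomogeneous_affP C D j)).sub ((isXWHomogeneous_wP j).pow 2)

theorem isXWHomogeneous_sepP (C : Matrix (Fin m) (Fin n) ℝ) (D : Matrix (Fin m) (Fin m) ℝ)
    (J : Finset (Fin m)) : IsXWHomogeneous (sepP C D J) m := by
  have h1 : IsXWHomogeneous (∏ j ∈ J, wP j : XWPoly n m) (∑ j ∈ J, 1) :=
    IsWeightedHomogeneous.prod _ _ _ fun j _ => isXWHomogeneous_wP j
  have h2 : IsXWHomogeneous (∏ j ∈ Jᶜ, slackP C D j) (∑ j ∈ Jᶜ, 1) :=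
    IsWeightedHomogeneous.prod _ _ _ fun j _ => isXWHomogeneous_slackP C D j
  have := h1.mul h2
  rw [Finset.sum_add_sum_compl] at this
  simpa using! this

theorem isXWHomogeneous_rename {g : MvPolynomial (Fin n ⊕ Fin m) ℝ} {l : ℕ}
    (hg : g.IsHomogeneous l) : IsXWHomogeneous (rename Sum.inl g) l := by
  intro d hd
  obtain ⟨e, rfl, he⟩ := coeff_rename_ne_zero _ _ _ hd
  rw [← hg he, Finsupp.weight_apply, Finsupp.weight_apply, Finsupp.sum_mapDomain_index]
  · rfl
  · simp
  · intros; simp [add_mul]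

/-! ### Reduction modulo the equations with bounded degree in the eigenvalue -/

section Trunc

variable (A : Matrix (Fin n) (Fin n) ℝ) (B : Matrix (Fin n) (Fin m) ℝ)
    (C : Matrix (Fin m) (Fin n) ℝ) (D : Matrix (Fin m) (Fin m) ℝ)

/-- The combinations of the equations whose cofactors have degree at most `L` in `λ`. -/
def truncIdeal (L : ℕ) : Submodule ℝ (XWPoly n m) where
  carrier := {h | ∃ (p : Fin n → XWPoly n m) (q : Fin m → XWPoly n m),
    (∀ i, degreeOf (Sum.inr ()) (p i) ≤ L) ∧ (∀ j, degreeOf (Sum.inr ()) (q j) ≤ L) ∧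
      h = ∑ i, p i * eigEq A B i + ∑ j, q j * reluEq C D j}
  zero_mem' := ⟨0, 0, by simp, by simp, by simp⟩
  add_mem' := by
    rintro _ _ ⟨p, q, hp, hq, rfl⟩ ⟨p', q', hp', hq', rfl⟩
    refine ⟨p + p', q + q', fun i => (degreeOf_add_le _ _ _).trans (max_le (hp i) (hp' i)),
      fun i => (degreeOf_add_le _ _ _).trans (max_le (hq i) (hq' i)), ?_⟩
    simp only [Pi.add_apply, add_mul, Finset.sum_add_distrib]
    ring
  smul_mem' := by
    rintro c _ ⟨p, q, hp, hq, rfl⟩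
    refine ⟨c • p, c • q, fun i => ?_, fun i => ?_, ?_⟩
    · rw [Pi.smul_apply, smul_eq_C_mul]
      exact (degreeOf_C_mul_le _ _ _).trans (hp i)
    · rw [Pi.smul_apply, smul_eq_C_mul]
      exact (degreeOf_C_mul_le _ _ _).trans (hq i)
    · simp [Finset.smul_sum, smul_add]

variable {A B C D}

theorem truncIdeal_mono {L L' : ℕ} (h : L ≤ L') :
    truncIdeal A B C D L ≤ truncIdeal A B C D L' := by
  rintro _ ⟨p, q, hp, hq, rfl⟩
  exact ⟨p, q, fun i => (hp i).trans h, fun i => (hq i).trans h, rfl⟩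

theorem truncIdeal_le_eqIdeal {L : ℕ} {h : XWPoly n m} (hh : h ∈ truncIdeal A B C D L) :
    h ∈ eqIdeal A B C D := by
  obtain ⟨p, q, -, -, rfl⟩ := hh
  exact mem_eqIdeal_iff.mpr ⟨p, q, rfl⟩

theorem mul_eigEq_mem_truncIdeal {L : ℕ} {p : XWPoly n m} (hp : degreeOf (Sum.inr ()) p ≤ L)
    (i : Fin n) : p * eigEq A B i ∈ truncIdeal A B C D L := by
  classical
  refine ⟨Pi.single i p, 0, fun k => ?_, by simp, ?_⟩
  · by_cases h : k = i
    · subst h; simpa using hp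
    · simp [h]
  · simp [Pi.single_apply]

theorem mul_reluEq_mem_truncIdeal {L : ℕ} {p : XWPoly n m} (hp : degreeOf (Sum.inr ()) p ≤ L)
    (j : Fin m) : p * reluEq C D j ∈ truncIdeal A B C D L := by
  classical
  refine ⟨0, Pi.single j p, by simp, fun k => ?_, ?_⟩
  · by_cases h : k = j
    · subst h; simpa using hp
    · simp [h]
  · simp [Pi.single_apply]

theorem degreeOf_rename_inl (g : MvPolynomial (Fin n ⊕ Fin m) ℝ) :
    degreeOf (Sum.inr ()) (rename Sum.inl g : XWPoly n m) = 0 := by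
  rw [degreeOf_eq_sup, ← Nat.le_zero, Finset.sup_le_iff]
  intro d hd
  obtain ⟨e, rfl, he⟩ := coeff_rename_ne_zero _ _ _ (mem_support_iff.mp hd)
  rw [Finsupp.mapDomain_of_notMem_range]
  simp

theorem degreeOf_lamP_pow_mul_rename_le (k : ℕ) (g : MvPolynomial (Fin n ⊕ Fin m) ℝ) :
    degreeOf (Sum.inr ()) (lamP ^ k * rename Sum.inl g : XWPoly n m) ≤ k := by
  refine (degreeOf_mul_le _ _ _).trans ?_
  rw [degreeOf_rename_inl, lamP, degreeOf_X_self_pow]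
  simp

/-- The polynomials in `(x, w)` that are combinations of the equations with cofactors of degree at
most `L` in `λ` form an ideal of `ℝ[x, w]`. -/
def elimIdeal (A : Matrix (Fin n) (Fin n) ℝ) (B : Matrix (Fin n) (Fin m) ℝ)
    (C : Matrix (Fin m) (Fin n) ℝ) (D : Matrix (Fin m) (Fin m) ℝ) (L : ℕ) :
    Ideal (MvPolynomial (Fin n ⊕ Fin m) ℝ) where
  carrier := {g | rename Sum.inl g ∈ truncIdeal A B C D L}
  zero_mem' := by simp
  add_mem' := by
    intro a b ha hb
    simpa using add_mem ha hb
  smul_mem' := by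
    rintro c x ⟨p, q, hp, hq, h⟩
    refine ⟨fun i => rename Sum.inl c * p i, fun i => rename Sum.inl c * q i, fun i => ?_,
      fun i => ?_, ?_⟩
    · exact (degreeOf_mul_le _ _ _).trans (by rw [degreeOf_rename_inl, zero_add]; exact hp i)
    · exact (degreeOf_mul_le _ _ _).trans (by rw [degreeOf_rename_inl, zero_add]; exact hq i)
    · rw [smul_eq_mul, map_mul, h, mul_add, Finset.mul_sum, Finset.mul_sum]
      simp [mul_assoc]

/-- By the ascending chain condition in `ℝ[x, w]`, one bound on the degree in `λ` of the cofactors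
serves all polynomials in `(x, w)` in the ideal of the equations. -/
theorem exists_mem_truncIdeal_of_mem_eqIdeal (A : Matrix (Fin n) (Fin n) ℝ)
    (B : Matrix (Fin n) (Fin m) ℝ) (C : Matrix (Fin m) (Fin n) ℝ) (D : Matrix (Fin m) (Fin m) ℝ) :
    ∃ L₀, ∀ g : MvPolynomial (Fin n ⊕ Fin m) ℝ, rename Sum.inl g ∈ eqIdeal A B C D →
      rename Sum.inl g ∈ truncIdeal A B C D L₀ := by
  obtain ⟨L₀, hL₀⟩ := WellFoundedGT.monotone_chain_condition
    (⟨elimIdeal A B C D, fun _ _ h _ hx => truncIdeal_mono h hx⟩ :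
      ℕ →o Ideal (MvPolynomial (Fin n ⊕ Fin m) ℝ))
  refine ⟨L₀, fun g hg => ?_⟩
  obtain ⟨p, q, h⟩ := mem_eqIdeal_iff.mp hg
  let L := (∑ i, degreeOf (Sum.inr ()) (p i) + ∑ j, degreeOf (Sum.inr ()) (q j)) + L₀
  have hL : g ∈ elimIdeal A B C D L := by
    refine ⟨p, q, fun i => ?_, fun j => ?_, h⟩
    · have := Finset.single_le_sum (f := fun i => degreeOf (Sum.inr ()) (p i))
        (fun _ _ => Nat.zero_le _) (Finset.mem_univ i)
      simp only [L]
      omega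
    · have := Finset.single_le_sum (f := fun i => degreeOf (Sum.inr ()) (q i))
        (fun _ _ => Nat.zero_le _) (Finset.mem_univ j)
      simp only [L]
      omega
  have := hL₀ L (Nat.le_add_left _ _)
  change elimIdeal A B C D L₀ = elimIdeal A B C D L at this
  exact (this ▸ hL : g ∈ elimIdeal A B C D L₀)

theorem isHomogeneous_reluForm (C : Matrix (Fin m) (Fin n) ℝ) (D : Matrix (Fin m) (Fin m) ℝ)
    (j : Fin m) : (reluForm C D j).IsHomogeneous 2 :=
  ((isHomogeneous_X _ _).mul ((IsHomogeneous.sum _ _ _ fun _ _ => isHomogeneous_C_mul_X _ _).add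
    (IsHomogeneous.sum _ _ _ fun _ _ => isHomogeneous_C_mul_X _ _))).sub
    ((isHomogeneous_X _ _).pow 2)

/-- A form in `(x, w)` of high degree is a combination of the `x_i` modulo the equations
`e_{n+j}`. -/
theorem exists_forall_eq_sum_mul_X (C : Matrix (Fin m) (Fin n) ℝ) {D : Matrix (Fin m) (Fin m) ℝ}
    (hD : ‖Matrix.toEuclideanCLM (n := Fin m) (𝕜 := ℝ) D‖ < 1) :
    ∃ T, ∀ l ≥ T, ∀ g : MvPolynomial (Fin n ⊕ Fin m) ℝ, g.IsHomogeneous l →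
      ∃ (q : Fin m → MvPolynomial (Fin n ⊕ Fin m) ℝ) (r : Fin n → MvPolynomial (Fin n ⊕ Fin m) ℝ),
        (∀ i, (r i).IsHomogeneous (l - 1)) ∧
          g = ∑ j, q j * reluForm C D j + ∑ i, r i * X (Sum.inl i) := by
  obtain ⟨T, hT⟩ := Ideal.exists_pow_le_of_le_radical_of_fg
    (idealOfVars_le_radical (C := C) hD) (idealOfVars_fg _ _)
  refine ⟨T + 2, fun l hl g hg => ?_⟩
  have hmem : g ∈ idealOfVars (Fin n ⊕ Fin m) ℝ ^ T := by
    rw [mem_pow_idealOfVars_iff]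
    intro d hd
    have := hg.degree_eq_sum_deg_support hd
    change T ≤ ∑ i ∈ d.support, d i
    omega
  obtain ⟨a, ha, b, hb, rfl⟩ := Submodule.mem_sup.mp (hT hmem)
  obtain ⟨q, rfl⟩ := Ideal.mem_span_range_iff_exists_fun.mp ha
  obtain ⟨r, rfl⟩ := Ideal.mem_span_range_iff_exists_fun.mp hb
  refine ⟨fun j => weightedHomogeneousComponent 1 (l - 2) (q j),
    fun i => weightedHomogeneousComponent 1 (l - 1) (r i),
    fun i => weightedHomogeneousComponent_isWeightedHomogeneous (l - 1) (r i), ?_⟩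
  conv_lhs => rw [← IsWeightedHomogeneous.weightedHomogeneousComponent_same hg]
  rw [map_add,
    eq_sum_weightedHomogeneousComponent_mul (δ := fun _ => 2) _
      (fun j _ => isHomogeneous_reluForm C D j) (fun _ _ => by omega),
    eq_sum_weightedHomogeneousComponent_mul (δ := fun _ => 1) _
      (fun j _ => isHomogeneous_X _ _) (fun _ _ => by omega)]

/-- In high degree, `λ` can be eliminated: `λ x_i` is replaced by `(A x + B w)_i`. -/
theorem exists_lamP_pow_mul_sub_mem {T : ℕ}
    (hT : ∀ l ≥ T, ∀ g : MvPolynomial (Fin n ⊕ Fin m) ℝ, g.IsHomogeneous l →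
      ∃ (q : Fin m → MvPolynomial (Fin n ⊕ Fin m) ℝ) (r : Fin n → MvPolynomial (Fin n ⊕ Fin m) ℝ),
        (∀ i, (r i).IsHomogeneous (l - 1)) ∧
          g = ∑ j, q j * reluForm C D j + ∑ i, r i * X (Sum.inl i))
    {l : ℕ} (hl : T + 1 ≤ l) (k : ℕ) : ∀ g : MvPolynomial (Fin n ⊕ Fin m) ℝ, g.IsHomogeneous l →
      ∃ g' : MvPolynomial (Fin n ⊕ Fin m) ℝ, g'.IsHomogeneous l ∧
        lamP ^ k * rename Sum.inl g - rename Sum.inl g' ∈ truncIdeal A B C D k := by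
  induction k with
  | zero => exact fun g hg => ⟨g, hg, by simp⟩
  | succ k ih =>
    intro g hg
    obtain ⟨q, r, hr, h⟩ := hT l (by omega) g hg
    let lin : Fin n → MvPolynomial (Fin n ⊕ Fin m) ℝ := fun i =>
      ∑ k, MvPolynomial.C (A i k) * X (Sum.inl k) + ∑ j, MvPolynomial.C (B i j) * X (Sum.inr j)
    have hlin : ∀ i, (lin i).IsHomogeneous 1 := fun i =>
      (IsHomogeneous.sum _ _ _ fun i _ => isHomogeneous_C_mul_X _ _).add
        (IsHomogeneous.sum _ _ _ fun i _ => isHomogeneous_C_mul_X _ _)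
    have hlin' : ∀ i, lamP * xP i = rename Sum.inl (lin i) - eigEq A B i := fun i => by
      simp [lin, eigEq, xP, wP]
    obtain ⟨g', hg', hmem⟩ := ih (∑ i, r i * lin i) (IsHomogeneous.sum _ _ _ fun i _ => by
      have := (hr i).mul (hlin i)
      rwa [Nat.sub_add_cancel (by omega)] at this)
    refine ⟨g', hg', ?_⟩
    have key : lamP ^ (k + 1) * rename Sum.inl g - rename Sum.inl g' =
        ∑ j, (lamP ^ (k + 1) * rename Sum.inl (q j)) * reluEq C D j +
        ∑ i, (-(lamP ^ k * rename Sum.inl (r i))) * eigEq A B i +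
        (lamP ^ k * rename Sum.inl (∑ i, r i * lin i) - rename Sum.inl g') := by
      have e1 : (rename Sum.inl g : XWPoly n m) = ∑ j, rename Sum.inl (q j) * reluEq C D j +
          ∑ i, rename Sum.inl (r i) * xP i := by
        rw [h]
        simp [rename_reluForm, xP]
      have e2 : lamP * ∑ i, rename Sum.inl (r i) * xP i =
          rename Sum.inl (∑ i, r i * lin i) - ∑ i, rename Sum.inl (r i) * eigEq A B i := by
        rw [Finset.mul_sum, map_sum, ← Finset.sum_sub_distrib]
        refine Finset.sum_congr rfl fun i _ => ?_
        rw [map_mul, mul_left_comm, hlin']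
        ring
      rw [e1, mul_add, pow_succ, mul_assoc _ lamP, mul_assoc _ lamP, e2]
      simp only [neg_mul, Finset.sum_neg_distrib, mul_assoc, ← Finset.mul_sum]
      ring
    rw [key]
    refine add_mem (add_mem (sum_mem fun j _ => mul_reluEq_mem_truncIdeal ?_ j)
      (sum_mem fun i _ => mul_eigEq_mem_truncIdeal ?_ i)) (truncIdeal_mono (Nat.le_succ k) hmem)
    · exact degreeOf_lamP_pow_mul_rename_le _ _
    · rw [degreeOf_neg]
      exact (degreeOf_lamP_pow_mul_rename_le _ _).trans (Nat.le_succ k)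

theorem monomial_eq_lamP_pow_mul_rename (d : Var n m →₀ ℕ) (c : ℝ) :
    (monomial d c : XWPoly n m) = lamP ^ (d (Sum.inr ())) *
      rename Sum.inl (monomial (d.comapDomain Sum.inl Sum.inl_injective.injOn) c) := by
  rw [rename_monomial, lamP, X_pow_eq_monomial, monomial_mul, one_mul]
  refine congrArg (fun e => monomial e c) (Finsupp.ext fun u => ?_)
  rcases u with u | u
  · simp [Finsupp.mapDomain_apply Sum.inl_injective]
  · simp [Finsupp.mapDomain_of_notMem_range]

theorem weight_xwWeight (d : Var n m →₀ ℕ) : Finsupp.weight xwWeight d =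
    (d.comapDomain Sum.inl Sum.inl_injective.injOn).degree := by
  rw [Finsupp.weight_apply, Finsupp.sum_fintype _ _ (by simp), Finsupp.degree_eq_sum]
  simp [xwWeight, Finsupp.comapDomain_apply]

/-- Every form in `(x, w)` of high degree with coefficients in `ℝ[λ]` is congruent to a form
without `λ`. -/
theorem exists_sub_rename_mem_truncIdeal (A : Matrix (Fin n) (Fin n) ℝ)
    (B : Matrix (Fin n) (Fin m) ℝ) (C : Matrix (Fin m) (Fin n) ℝ) {D : Matrix (Fin m) (Fin m) ℝ}
    (hD : ‖Matrix.toEuclideanCLM (n := Fin m) (𝕜 := ℝ) D‖ < 1) :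
    ∃ T, ∀ l ≥ T, ∀ (L : ℕ) (h : XWPoly n m), IsXWHomogeneous h l →
      degreeOf (Sum.inr ()) h ≤ L → ∃ g : MvPolynomial (Fin n ⊕ Fin m) ℝ, g.IsHomogeneous l ∧
        h - rename Sum.inl g ∈ truncIdeal A B C D L := by
  obtain ⟨T, hT⟩ := exists_forall_eq_sum_mul_X C hD
  refine ⟨T + 1, fun l hl L h hh hL => ?_⟩
  have : ∀ d ∈ h.support, ∃ g : MvPolynomial (Fin n ⊕ Fin m) ℝ, g.IsHomogeneous l ∧
      monomial d (h.coeff d) - rename Sum.inl g ∈ truncIdeal A B C D L := by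
    intro d hd
    obtain ⟨g, hg, hm⟩ := exists_lamP_pow_mul_sub_mem (A := A) (B := B) hT hl (d (Sum.inr ()))
      (monomial (d.comapDomain Sum.inl Sum.inl_injective.injOn) (h.coeff d))
      (isHomogeneous_monomial _ (by rw [← weight_xwWeight]; exact hh (mem_support_iff.mp hd)))
    refine ⟨g, hg, ?_⟩
    rw [monomial_eq_lamP_pow_mul_rename]
    refine truncIdeal_mono ?_ hm
    rw [degreeOf_eq_sup] at hL
    exact (Finset.le_sup (f := fun d : Var n m →₀ ℕ => d (Sum.inr ())) hd).trans hL
  choose! g hg hm using this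
  refine ⟨∑ d ∈ h.support, g d, IsHomogeneous.sum _ _ _ hg, ?_⟩
  have e := h.as_sum
  rw [map_sum]
  nth_rewrite 1 [e]
  rw [ ← Finset.sum_sub_distrib]
  exact sum_mem hm

end Trunc

/-! ### Real interpolation at complex nodes -/

open scoped ComplexConjugate in
/-- Coefficientwise real parts of the Lagrange interpolant. At a conjugation-invariant set of nodes
the result takes at `μ` the mean of `v μ` and of the conjugate of `v (conj μ)`. -/
theorem exists_real_interpolant (s : Finset ℂ) (hs : ∀ μ ∈ s, conj μ ∈ s) (v : ℂ → ℂ) :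
    ∃ P : Polynomial ℝ, P.degree < s.card ∧
      ∀ μ ∈ s, Polynomial.aeval μ P = (v μ + conj (v (conj μ))) / 2 := by
  classical
  let Q : Polynomial ℂ := Lagrange.interpolate s id v
  have hQdeg : Q.degree < s.card := Lagrange.degree_interpolate_lt _ Function.injective_id.injOn
  have hQ : ∀ μ ∈ s, Q.eval μ = v μ := fun μ hμ =>
    Lagrange.eval_interpolate_at_node (v := id) v Function.injective_id.injOn hμ
  let P : Polynomial ℝ := ∑ k ∈ Finset.range s.card, Polynomial.monomial k (Q.coeff k).re
  have hcoeff : ∀ k, P.coeff k = (Q.coeff k).re := by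
    intro k
    simp only [P, Polynomial.finsetSum_coeff, Polynomial.coeff_monomial, Finset.sum_ite_eq',
      Finset.mem_range]
    split_ifs with h
    · rfl
    · rw [Polynomial.coeff_eq_zero_of_degree_lt (hQdeg.trans_le (by exact_mod_cast not_lt.mp h))]
      rfl
  refine ⟨P, ?_, fun μ hμ => ?_⟩
  · rw [Polynomial.degree_lt_iff_coeff_zero]
    intro k hk
    rw [hcoeff, Polynomial.coeff_eq_zero_of_degree_lt (hQdeg.trans_le (by exact_mod_cast hk))]
    rfl
  · have hP : P.map (algebraMap ℝ ℂ) = Polynomial.C (1 / 2) * (Q + Q.map (starRingEnd ℂ)) := by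
      ext k
      rw [Polynomial.coeff_map, hcoeff, Polynomial.coeff_C_mul, Polynomial.coeff_add,
        Polynomial.coeff_map, Complex.add_conj]
      simp
    have hconj : (Q.map (starRingEnd ℂ)).eval μ = conj (Q.eval (conj μ)) := by
      rw [← Polynomial.eval_map_apply, Complex.conj_conj]
    rw [← Polynomial.eval_map_algebraMap, hP, Polynomial.eval_mul, Polynomial.eval_C,
      Polynomial.eval_add, hconj, hQ _ hμ, hQ _ (hs _ hμ)]
    ring

/-! ### The eigenvectors as values of real polynomials in the eigenvalue -/

section Points

variable (A : Matrix (Fin n) (Fin n) ℝ) (B : Matrix (Fin n) (Fin m) ℝ)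
    (C : Matrix (Fin m) (Fin n) ℝ) (D : Matrix (Fin m) (Fin m) ℝ)

/-- The complex eigenvalues of `A + B F_J C` as a finite set. -/
def eigFinset (J : Finset (Fin m)) : Finset ℂ :=
  ((modeReal A B C D J).charpoly.map (algebraMap ℝ ℂ)).roots.toFinset

/-- The complex eigenvalues of all matrices `A + B F_J C`. -/
def allEigs : Finset ℂ := Finset.univ.biUnion (eigFinset A B C D)

variable {A B C D}

theorem mem_eigFinset {J : Finset (Fin m)} {μ : ℂ} :
    μ ∈ eigFinset A B C D J ↔ Polynomial.aeval μ (modeReal A B C D J).charpoly = 0 := by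
  have : (modeReal A B C D J).charpoly.map (algebraMap ℝ ℂ) ≠ 0 :=
    ((modeReal A B C D J).charpoly_monic.map _).ne_zero
  rw [eigFinset, Multiset.mem_toFinset, Polynomial.mem_roots this, Polynomial.IsRoot.def,
    Polynomial.eval_map_algebraMap]

theorem mem_allEigs {μ : ℂ} : μ ∈ allEigs A B C D ↔ ∃ J, μ ∈ eigFinset A B C D J := by
  simp [allEigs]

theorem coe_eigFinset (J : Finset (Fin m)) :
    (eigFinset A B C D J : Set ℂ) = modeEigs A B C D J := by
  ext μ
  have h : modeMatrix A B C D J = (modeReal A B C D J).map (algebraMap ℝ ℂ) := rfl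
  rw [Finset.mem_coe, mem_eigFinset, modeEigs, Set.mem_ofPred_eq,
    Module.End.hasEigenvalue_iff_isRoot_charpoly, Matrix.charpoly_toLin', h,
    Matrix.charpoly_map, Polynomial.IsRoot.def,
    Polynomial.eval_map_algebraMap]

open scoped ComplexConjugate in
theorem conj_mem_eigFinset {J : Finset (Fin m)} {μ : ℂ} (h : μ ∈ eigFinset A B C D J) :
    conj μ ∈ eigFinset A B C D J := by
  rw [mem_eigFinset] at h ⊢
  rw [Polynomial.aeval_conj, h, map_zero]

theorem card_eigFinset (hgen : IsGeneric A B C D) (J : Finset (Fin m)) :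
    (eigFinset A B C D J).card = n := by
  rw [← Set.ncard_coe_finset, coe_eigFinset, hgen.eigs_card]

/-- The `2^m` spectra of `n` elements each are disjoint, as their union has `n 2^m` elements. -/
theorem eq_of_mem_eigFinset (hgen : IsGeneric A B C D) {J J' : Finset (Fin m)} {μ : ℂ}
    (h : μ ∈ eigFinset A B C D J) (h' : μ ∈ eigFinset A B C D J') : J = J' := by
  classical
  by_contra hne
  have hcard : (allEigs A B C D).card = n * 2 ^ m := by
    rw [← hgen.all_eigs_card, ← Set.ncard_coe_finset, allEigs, Finset.coe_biUnion]
    simp [coe_eigFinset]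
  -- the union does not change when the common element is removed from one of the two spectra
  have hsub : allEigs A B C D ⊆ Finset.univ.biUnion fun K =>
      if K = J then (eigFinset A B C D J).erase μ else eigFinset A B C D K := by
    intro ν hν
    obtain ⟨K, hK⟩ := mem_allEigs.mp hν
    rw [Finset.mem_biUnion]
    by_cases hνμ : ν = μ
    · exact ⟨J', Finset.mem_univ _, by rw [if_neg (Ne.symm hne), hνμ]; exact h'⟩
    · refine ⟨K, Finset.mem_univ _, ?_⟩
      split_ifs with e
      · exact Finset.mem_erase.mpr ⟨hνμ, e ▸ hK⟩
      · exact hK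
  have h1 := (Finset.card_le_card hsub).trans Finset.card_biUnion_le
  have h2 : ∑ K, (if K = J then (eigFinset A B C D J).erase μ else eigFinset A B C D K).card <
      ∑ K : Finset (Fin m), n := by
    refine Finset.sum_lt_sum (fun K _ => ?_) ⟨J, Finset.mem_univ _, ?_⟩
    · split_ifs with e
      · exact (Finset.card_erase_le).trans (card_eigFinset hgen J).le
      · exact (card_eigFinset hgen K).le
    · rw [if_pos rfl]
      exact (Finset.card_erase_lt_of_mem h).trans_eq (card_eigFinset hgen J)
  rw [hcard] at h1
  simp only [Finset.sum_const, Finset.card_univ, Fintype.card_finset, Fintype.card_fin,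
    smul_eq_mul] at h2
  rw [mul_comm] at h2
  exact absurd h1 (not_le.mpr h2)

theorem isCoprime_charpoly (hgen : IsGeneric A B C D) (J J' : Finset (Fin m)) (hne : J ≠ J') :
    IsCoprime (modeReal A B C D J).charpoly (modeReal A B C D J').charpoly := by
  rw [Polynomial.isCoprime_iff_aeval_ne_zero_of_isAlgClosed ℝ ℂ]
  intro μ
  by_contra! h
  exact hne (eq_of_mem_eigFinset hgen (mem_eigFinset.mpr h.1) (mem_eigFinset.mpr h.2))

/-- Each eigenvalue has an eigenvector with first coordinate `1`. -/
theorem exists_normalized_eigenvector (hgen : IsGeneric A B C D) {J : Finset (Fin m)} {μ : ℂ}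
    (h : μ ∈ eigFinset A B C D J) : ∃ v : Fin n → ℂ,
      actVec (modeReal A B C D J) v = μ • v ∧ ∀ i : Fin n, (i : ℕ) = 0 → v i = 1 := by
  have hμ : μ ∈ modeEigs A B C D J := by rw [← coe_eigFinset]; exact h
  obtain ⟨z, hz⟩ : (unitEigvecs A B C D J μ).Nonempty := by
    apply Set.nonempty_of_ncard_ne_zero
    rw [hgen.unit_card J μ hμ]
    decide
  have hn : 0 < n := by
    rw [← card_eigFinset hgen J]
    exact Finset.card_pos.mpr ⟨μ, h⟩
  have h0 : z.1 ⟨0, hn⟩ ≠ 0 := hgen.first_coord_ne_zero J μ z hz _ rfl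
  have hv : actVec (modeReal A B C D J) z.1 = μ • z.1 := hz.1
  refine ⟨(z.1 ⟨0, hn⟩)⁻¹ • z.1, ?_, fun i hi => ?_⟩
  · rw [actVec_smul, hv, smul_comm]
  · obtain rfl : i = ⟨0, hn⟩ := Fin.ext hi
    simp [h0]

variable (A B C D) in
/-- Real polynomials in `λ` whose values at every eigenvalue `μ` of a matrix `A + B F_J C` are the
coordinates of an eigenvector `(v, F_J C v)` with first coordinate `1`. The normalization is a
condition only where there is a first coordinate, that is, for `0 < n`. -/
structure IsEigCurve (r : Fin n ⊕ Fin m → Polynomial ℝ) : Prop where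
  eig : ∀ J, ∀ μ ∈ eigFinset A B C D J,
    actVec (modeReal A B C D J) (fun i => Polynomial.aeval μ (r (Sum.inl i))) =
      μ • fun i => Polynomial.aeval μ (r (Sum.inl i))
  lift : ∀ J, ∀ μ ∈ eigFinset A B C D J,
    (fun j => Polynomial.aeval μ (r (Sum.inr j))) =
      actVec (blockInv D J * C) fun i => Polynomial.aeval μ (r (Sum.inl i))
  first : ∀ J, ∀ μ ∈ eigFinset A B C D J, ∀ i : Fin n, (i : ℕ) = 0 →
    Polynomial.aeval μ (r (Sum.inl i)) = 1

open scoped ComplexConjugate in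
theorem conj_mem_allEigs {μ : ℂ} (h : μ ∈ allEigs A B C D) : conj μ ∈ allEigs A B C D := by
  obtain ⟨J, hJ⟩ := mem_allEigs.mp h
  exact mem_allEigs.mpr ⟨J, conj_mem_eigFinset hJ⟩

open scoped ComplexConjugate in
theorem conj_actVec {k l : ℕ} (N : Matrix (Fin k) (Fin l) ℝ) (v : Fin l → ℂ) (i : Fin k) :
    conj (actVec N v i) = actVec N (fun j => conj (v j)) i := by
  simp [actVec_apply]

open scoped ComplexConjugate in
/-- Averaging `v μ` with the conjugate of `v (conj μ)` preserves the linear equations that define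
the eigenvector, so real interpolation applies. -/
theorem exists_isEigCurve (hgen : IsGeneric A B C D) :
    ∃ r : Fin n ⊕ Fin m → Polynomial ℝ, IsEigCurve A B C D r := by
  classical
  have hex : ∀ μ : ℂ, ∃ v : Fin n ⊕ Fin m → ℂ, ∀ J, μ ∈ eigFinset A B C D J →
      actVec (modeReal A B C D J) (fun i => v (Sum.inl i)) = μ • (fun i => v (Sum.inl i)) ∧
      (fun j => v (Sum.inr j)) = actVec (blockInv D J * C) (fun i => v (Sum.inl i)) ∧
      ∀ i : Fin n, (i : ℕ) = 0 → v (Sum.inl i) = 1 := by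
    intro μ
    by_cases hμ : μ ∈ allEigs A B C D
    · obtain ⟨J, hJ⟩ := mem_allEigs.mp hμ
      obtain ⟨v, hv, hv1⟩ := exists_normalized_eigenvector hgen hJ
      refine ⟨Sum.elim v (actVec (blockInv D J * C) v), fun J' hJ' => ?_⟩
      obtain rfl := eq_of_mem_eigFinset hgen hJ hJ'
      exact ⟨hv, rfl, hv1⟩
    · exact ⟨0, fun J hJ => absurd (mem_allEigs.mpr ⟨J, hJ⟩) hμ⟩
  choose v hv using hex
  have hint := fun u => exists_real_interpolant (allEigs A B C D) (fun _ h => conj_mem_allEigs h)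
    (fun μ => v μ u)
  choose r hdeg hr using hint
  have hr' : ∀ J, ∀ μ ∈ eigFinset A B C D J, ∀ u,
      Polynomial.aeval μ (r u) = (2⁻¹ : ℂ) * (v μ u + conj (v (conj μ) u)) := by
    intro J μ hμ u
    rw [hr u μ (mem_allEigs.mpr ⟨J, hμ⟩), div_eq_inv_mul]
  have hact : ∀ {k : ℕ} (N : Matrix (Fin k) (Fin n) ℝ) (μ : ℂ) (i : Fin k),
      actVec N (fun i => (2⁻¹ : ℂ) * (v μ (Sum.inl i) + conj (v (conj μ) (Sum.inl i)))) i =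
      2⁻¹ * (actVec N (fun i => v μ (Sum.inl i)) i +
        conj (actVec N (fun i => v (conj μ) (Sum.inl i)) i)) := by
    intro k N μ i
    rw [conj_actVec]
    simp only [actVec_apply, Finset.mul_sum, ← Finset.sum_add_distrib]
    exact Finset.sum_congr rfl fun _ _ => by ring
  refine ⟨r, fun J μ hμ => ?_, fun J μ hμ => ?_, fun J μ hμ i hi => ?_⟩
  · ext i
    simp only [hr' J μ hμ, hact, (hv μ J hμ).1, (hv _ J (conj_mem_eigFinset hμ)).1]
    simp only [Pi.smul_apply, smul_eq_mul, map_mul, Complex.conj_conj]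
    ring
  · ext j
    simp only [hr' J μ hμ, hact, ← (hv μ J hμ).2.1, ← (hv _ J (conj_mem_eigFinset hμ)).2.1]
  · rw [hr' J μ hμ, (hv μ J hμ).2.2 i hi, (hv _ J (conj_mem_eigFinset hμ)).2.2 i hi]
    norm_num

/-- The eigenvectors of `A + B F_J C` span, so a real linear form vanishing at all of them is
zero. -/
theorem IsEigCurve.eq_zero_of_forall_sum_eq_zero (hgen : IsGeneric A B C D)
    {r : Fin n ⊕ Fin m → Polynomial ℝ} (hr : IsEigCurve A B C D r) (J : Finset (Fin m))
    {c : Fin n → ℝ} (hc : ∀ μ ∈ eigFinset A B C D J,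
      ∑ i, (c i : ℂ) * Polynomial.aeval μ (r (Sum.inl i)) = 0) : c = 0 := by
  classical
  let b : eigFinset A B C D J → Fin n → ℂ := fun μ i => Polynomial.aeval (μ : ℂ) (r (Sum.inl i))
  have hli : LinearIndependent ℂ b := by
    refine Module.End.eigenvectors_linearIndependent' (Matrix.toLin' (modeMatrix A B C D J))
      (fun μ : eigFinset A B C D J => (μ : ℂ)) Subtype.val_injective b fun μ => ?_
    refine Module.End.hasEigenvector_iff.mpr ⟨Module.End.mem_eigenspace_iff.mpr ?_, ?_⟩
    · rw [Matrix.toLin'_apply]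
      exact hr.eig J μ μ.2
    · have hn : 0 < n := by
        rw [← card_eigFinset hgen J]
        exact Finset.card_pos.mpr ⟨μ, μ.2⟩
      intro h
      have h1 := hr.first J μ μ.2 ⟨0, hn⟩ rfl
      exact one_ne_zero (h1.symm.trans (congrFun h ⟨0, hn⟩))
  have hspan := hli.span_eq_top_of_card_eq_finrank' (by
    rw [Fintype.card_coe, card_eigFinset hgen, Module.finrank_fin_fun])
  let φ : (Fin n → ℂ) →ₗ[ℂ] ℂ := ∑ i, (c i : ℂ) • LinearMap.proj i
  have hφ : φ = 0 := LinearMap.ext_on hspan (by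
    rintro _ ⟨μ, rfl⟩
    simpa [φ, b] using hc μ μ.2)
  ext i
  have := LinearMap.congr_fun hφ (Pi.single i 1)
  simpa [φ, Pi.single_apply] using this

end Points

/-! ### Forms vanishing at the eigenvectors -/

/-- The coefficients of the linear form `x_1` (of the zero form if `n = 0`). -/
def firstCoeff (k : Fin n) : ℝ := if (k : ℕ) = 0 then 1 else 0

/-- The coordinate `x_1`, or `0` if `n = 0`. -/
def firstP : XWPoly n m := ∑ k, MvPolynomial.C (firstCoeff k) * xP k

/-- Evaluation at the point with coordinates `r_u(μ)` and with `λ = μ`. -/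
def evalCurve (r : Fin n ⊕ Fin m → Polynomial ℝ) (μ : ℂ) : XWPoly n m →ₐ[ℝ] ℂ :=
  aeval (Sum.elim (fun u => Polynomial.aeval μ (r u)) fun _ => μ)

section Vanishing

variable {A : Matrix (Fin n) (Fin n) ℝ} {B : Matrix (Fin n) (Fin m) ℝ}
    {C : Matrix (Fin m) (Fin n) ℝ} {D : Matrix (Fin m) (Fin m) ℝ}
    {r : Fin n ⊕ Fin m → Polynomial ℝ}

@[simp] theorem evalCurve_X_inl (μ : ℂ) (u : Fin n ⊕ Fin m) :
    evalCurve r μ (X (Sum.inl u)) = Polynomial.aeval μ (r u) := by simp [evalCurve]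

@[simp] theorem evalCurve_xP (μ : ℂ) (i : Fin n) :
    evalCurve r μ (xP i) = Polynomial.aeval μ (r (Sum.inl i)) := by simp [xP]

@[simp] theorem evalCurve_wP (μ : ℂ) (j : Fin m) :
    evalCurve r μ (wP j) = Polynomial.aeval μ (r (Sum.inr j)) := by simp [wP]

@[simp] theorem evalCurve_lamP (μ : ℂ) : evalCurve r μ lamP = μ := by simp [evalCurve, lamP]

theorem sum_aeval_mul_eq {Q : Type*} [CommRing Q] [Algebra ℝ Q] {M : Matrix (Fin n) (Fin n) ℝ}
    {Y : Fin n → Q} {t : Q} (h : actVec M Y = t • Y) (P : Fin n → Polynomial ℝ) :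
    ∑ k, Polynomial.aeval t (P k) * Y k =
      ∑ l, algebraMap ℝ Q (∑ k, (Polynomial.aeval M (P k)) k l) * Y l := by
  have : ∀ k, Polynomial.aeval t (P k) * Y k =
      ∑ l, algebraMap ℝ Q ((Polynomial.aeval M (P k)) k l) * Y l := fun k => by
    rw [← actVec_apply, actVec_aeval h (P k)]
    rfl
  simp only [this, map_sum, Finset.sum_mul]
  exact Finset.sum_comm

/-- Substituting `r_u(λ)` for the `(x, w)`-coordinates and then evaluating `λ`. -/
theorem aeval_aeval_elim {Q : Type*} [CommRing Q] [Algebra ℝ Q] (t : Q) (a : XWPoly n m) :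
    Polynomial.aeval t (aeval (Sum.elim r fun _ => Polynomial.X) a) =
      aeval (Sum.elim (fun u => Polynomial.aeval t (r u)) fun _ => t) a := by
  refine DFunLike.congr_fun (f := (Polynomial.aeval t).comp
    (aeval (Sum.elim r fun _ => Polynomial.X))) (algHom_ext ?_) a
  rintro (u | u) <;> simp

theorem pos_of_mem_eigFinset (hgen : IsGeneric A B C D) {J : Finset (Fin m)} {μ : ℂ}
    (h : μ ∈ eigFinset A B C D J) : 0 < n := by
  rw [← card_eigFinset hgen J]
  exact Finset.card_pos.mpr ⟨μ, h⟩

namespace IsEigCurve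

theorem evalCurve_wP_eq_zero (hr : IsEigCurve A B C D r) {J : Finset (Fin m)} {μ : ℂ}
    (hμ : μ ∈ eigFinset A B C D J) {j : Fin m} (hj : j ∉ J) : evalCurve r μ (wP j) = 0 := by
  rw [evalCurve_wP]
  exact (congrFun (hr.lift J μ hμ) j).trans (actVec_blockInv_eq_zero C D _ hj)

theorem evalCurve_slackP_eq_zero (hr : IsEigCurve A B C D r)
    (hD : ‖Matrix.toEuclideanCLM (n := Fin m) (𝕜 := ℝ) D‖ < 1) {J : Finset (Fin m)} {μ : ℂ}
    (hμ : μ ∈ eigFinset A B C D J) {j : Fin m} (hj : j ∈ J) :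
    evalCurve r μ (slackP C D j) = 0 := by
  rw [map_slackP, sub_eq_zero]
  simp only [evalCurve_wP, evalCurve_xP, hr.lift J μ hμ]
  exact (congrFun (hr.lift J μ hμ) j).trans (actVec_blockInv_eq hD _ hj)

theorem evalCurve_eigEq_eq_zero (hr : IsEigCurve A B C D r) {J : Finset (Fin m)} {μ : ℂ}
    (hμ : μ ∈ eigFinset A B C D J) (i : Fin n) : evalCurve r μ (eigEq A B i) = 0 := by
  rw [map_eigEq, sub_eq_zero]
  simp only [evalCurve_wP, evalCurve_xP, hr.lift J μ hμ, evalCurve_lamP]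
  have := congrFun (hr.eig J μ hμ) i
  rwa [actVec_modeReal] at this

theorem evalCurve_reluEq_eq_zero (hr : IsEigCurve A B C D r)
    (hD : ‖Matrix.toEuclideanCLM (n := Fin m) (𝕜 := ℝ) D‖ < 1) {J : Finset (Fin m)} {μ : ℂ}
    (hμ : μ ∈ eigFinset A B C D J) (j : Fin m) : evalCurve r μ (reluEq C D j) = 0 := by
  rw [map_reluEq]
  by_cases hj : j ∈ J
  · rw [hr.evalCurve_slackP_eq_zero hD hμ hj, zero_mul, neg_zero]
  · rw [hr.evalCurve_wP_eq_zero hμ hj, mul_zero, neg_zero]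

theorem evalCurve_firstP (hr : IsEigCurve A B C D r) (hgen : IsGeneric A B C D)
    {J : Finset (Fin m)} {μ : ℂ} (hμ : μ ∈ eigFinset A B C D J) :
    evalCurve r μ firstP = 1 := by
  have hn := pos_of_mem_eigFinset hgen hμ
  have h1 := hr.first J μ hμ ⟨0, hn⟩ rfl
  rw [firstP, map_sum, Finset.sum_eq_single ⟨0, hn⟩]
  · simp [firstCoeff, ← algebraMap_eq, h1]
  · intro k _ hk
    have : (k : ℕ) ≠ 0 := fun h => hk (Fin.ext h)
    simp [firstCoeff, this]
  · simp

/-- An eigenvalue of the pattern `J` determines `J`: no other pattern is valid at its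
eigenvector. -/
theorem eq_of_relations (hr : IsEigCurve A B C D r) (hgen : IsGeneric A B C D)
    (hD : ‖Matrix.toEuclideanCLM (n := Fin m) (𝕜 := ℝ) D‖ < 1) {J J' : Finset (Fin m)} {μ : ℂ}
    (hμ : μ ∈ eigFinset A B C D J) (h0 : ∀ j ∉ J', evalCurve r μ (wP j) = 0)
    (h1 : ∀ j ∈ J', evalCurve r μ (slackP C D j) = 0) : J = J' := by
  obtain ⟨-, hM⟩ := mode_relations (A := A) (B := B) (evalCurve r μ) hD h0 h1
    (hr.evalCurve_eigEq_eq_zero hμ)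
  refine eq_of_mem_eigFinset hgen hμ (mem_eigFinset.mpr ?_)
  have hn := pos_of_mem_eigFinset hgen hμ
  have h := congrFun (actVec_aeval hM (modeReal A B C D J').charpoly) ⟨0, hn⟩
  rw [Matrix.aeval_self_charpoly, Pi.smul_apply, evalCurve_xP, hr.first J μ hμ _ rfl,
    evalCurve_lamP, smul_eq_mul, mul_one] at h
  rw [← h]
  simp [actVec_apply]

theorem evalCurve_sepP_ne_zero (hr : IsEigCurve A B C D r) (hgen : IsGeneric A B C D)
    (hD : ‖Matrix.toEuclideanCLM (n := Fin m) (𝕜 := ℝ) D‖ < 1) {J : Finset (Fin m)} {μ : ℂ}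
    (hμ : μ ∈ eigFinset A B C D J) : evalCurve r μ (sepP C D J) ≠ 0 := by
  classical
  rw [sepP, map_mul, map_prod, map_prod]
  refine mul_ne_zero (Finset.prod_ne_zero_iff.mpr fun j hj h => ?_)
    (Finset.prod_ne_zero_iff.mpr fun j hj h => ?_)
  · have := hr.eq_of_relations (J' := J.erase j) hgen hD hμ (fun k hk => ?_) (fun k hk => ?_)
    · exact Finset.notMem_erase j J (this ▸ hj)
    · by_cases hkj : k = j
      · rw [hkj, h]
      · exact hr.evalCurve_wP_eq_zero hμ fun hk' => hk (Finset.mem_erase.mpr ⟨hkj, hk'⟩)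
    · exact hr.evalCurve_slackP_eq_zero hD hμ (Finset.mem_of_mem_erase hk)
  · have := hr.eq_of_relations (J' := insert j J) hgen hD hμ (fun k hk => ?_) (fun k hk => ?_)
    · exact (Finset.mem_compl.mp hj) (this ▸ Finset.mem_insert_self j J)
    · exact hr.evalCurve_wP_eq_zero hμ fun hk' => hk (Finset.mem_insert_of_mem hk')
    · rcases Finset.mem_insert.mp hk with rfl | hk
      · exact h
      · exact hr.evalCurve_slackP_eq_zero hD hμ hk

theorem evalCurve_sepP_eq_zero (hr : IsEigCurve A B C D r)
    (hD : ‖Matrix.toEuclideanCLM (n := Fin m) (𝕜 := ℝ) D‖ < 1) {J J' : Finset (Fin m)} {μ : ℂ}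
    (hμ : μ ∈ eigFinset A B C D J) (hne : J' ≠ J) : evalCurve r μ (sepP C D J') = 0 := by
  rw [sepP, map_mul, map_prod, map_prod, mul_eq_zero]
  by_cases h : J' ⊆ J
  · obtain ⟨j, hj, hj'⟩ := Finset.exists_of_ssubset (h.ssubset_of_ne hne)
    exact Or.inr (Finset.prod_eq_zero (Finset.mem_compl.mpr hj')
      (hr.evalCurve_slackP_eq_zero hD hμ hj))
  · obtain ⟨j, hj, hj'⟩ := Finset.not_subset.mp h
    exact Or.inl (Finset.prod_eq_zero hj (hr.evalCurve_wP_eq_zero hμ hj'))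

theorem evalCurve_eq_zero_of_mem_eqIdeal (hr : IsEigCurve A B C D r)
    (hD : ‖Matrix.toEuclideanCLM (n := Fin m) (𝕜 := ℝ) D‖ < 1) {μ : ℂ}
    (hμ : μ ∈ allEigs A B C D) {h : XWPoly n m} (hh : h ∈ eqIdeal A B C D) :
    evalCurve r μ h = 0 := by
  obtain ⟨J, hJ⟩ := mem_allEigs.mp hμ
  obtain ⟨p, q, rfl⟩ := mem_eqIdeal_iff.mp hh
  simp [hr.evalCurve_eigEq_eq_zero hJ, hr.evalCurve_reluEq_eq_zero hD hJ]

/-- A linear form in `x` with coefficients in `ℝ[λ]` that vanishes at the eigenvectors of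
`M = A + B F_J C` vanishes wherever `M x = λ x` over a commutative `ℝ`-algebra: each power of `λ`
can be replaced by a power of `M`, which leaves a real linear form. -/
theorem sum_aeval_mul_eq_zero (hr : IsEigCurve A B C D r) (hgen : IsGeneric A B C D)
    {Q : Type*} [CommRing Q] [Algebra ℝ Q] {J : Finset (Fin m)} {Y : Fin n → Q} {t : Q}
    (hM : actVec (modeReal A B C D J) Y = t • Y) (P : Fin n → Polynomial ℝ)
    (hP : ∀ μ ∈ eigFinset A B C D J,
      ∑ k, Polynomial.aeval μ (P k) * Polynomial.aeval μ (r (Sum.inl k)) = 0) :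
    ∑ k, Polynomial.aeval t (P k) * Y k = 0 := by
  have hc : (fun l => ∑ k, (Polynomial.aeval (modeReal A B C D J) (P k)) k l) = 0 :=
    hr.eq_zero_of_forall_sum_eq_zero hgen J fun μ hμ =>
      (sum_aeval_mul_eq (hr.eig J μ hμ) P).symm.trans (hP μ hμ)
  rw [sum_aeval_mul_eq hM]
  refine Finset.sum_eq_zero fun l _ => ?_
  rw [show ∑ k, (Polynomial.aeval (modeReal A B C D J) (P k)) k l = 0 from congrFun hc l,
    map_zero, zero_mul]

end IsEigCurve

/-- Scaling the `(x, w)`-coordinates of a form. -/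
theorem IsXWHomogeneous.aeval_mul {Q : Type*} [CommRing Q] [Algebra ℝ Q] {a : XWPoly n m} {l : ℕ}
    (ha : IsXWHomogeneous a l) (g : Fin n ⊕ Fin m → Q) (c t : Q) :
    aeval (Sum.elim (fun u => g u * c) fun _ => t) a =
      aeval (Sum.elim g fun _ => t) a * c ^ l := by
  have e := a.as_sum
  rw [e, map_sum, map_sum, Finset.sum_mul]
  refine Finset.sum_congr rfl fun d hd => ?_
  have hl : l = ∑ u, d (Sum.inl u) := by
    rw [← ha (mem_support_iff.mp hd), Finsupp.weight_apply, Finsupp.sum_fintype _ _ (by simp)]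
    simp [xwWeight]
  rw [aeval_monomial, aeval_monomial, Finsupp.prod_fintype _ _ (by simp),
    Finsupp.prod_fintype _ _ (by simp), hl]
  simp only [Fintype.prod_sum_type, Fintype.sum_sum_type, Sum.elim_inl, Sum.elim_inr, mul_pow,
    Finset.prod_mul_distrib, Finset.prod_pow_eq_pow_sum, pow_add]
  ring

/-- A form of positive degree that vanishes at all eigenvectors of the pattern `J` lies in the
ideal of `J`. Modulo this ideal every `x_i` and `w_j` is a polynomial in `λ` times `x_1`. -/
theorem mem_modeIdeal (hr : IsEigCurve A B C D r) (hgen : IsGeneric A B C D)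
    (hD : ‖Matrix.toEuclideanCLM (n := Fin m) (𝕜 := ℝ) D‖ < 1) {J : Finset (Fin m)}
    {a : XWPoly n m} {l : ℕ} (ha : IsXWHomogeneous a l) (hl : 1 ≤ l)
    (h0 : ∀ μ ∈ eigFinset A B C D J, evalCurve r μ a = 0) : a ∈ modeIdeal A B C D J := by
  classical
  let ψ := Ideal.Quotient.mkₐ ℝ (modeIdeal A B C D J)
  obtain ⟨hW, hM⟩ := mode_relations (A := A) (B := B) (C := C) (D := D) (J := J) ψ hD
    (fun j hj => Ideal.Quotient.eq_zero_iff_mem.mpr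
      (Ideal.subset_span (Or.inr (Or.inl ⟨j, hj, rfl⟩))))
    (fun j hj => Ideal.Quotient.eq_zero_iff_mem.mpr
      (Ideal.subset_span (Or.inr (Or.inr ⟨j, hj, rfl⟩))))
    (fun i => Ideal.Quotient.eq_zero_iff_mem.mpr (Ideal.subset_span (Or.inl ⟨i, rfl⟩)))
  have hfirst : ∀ P : Polynomial ℝ, Polynomial.aeval (ψ lamP) P * ψ firstP =
      ∑ k, Polynomial.aeval (ψ lamP) (P * Polynomial.C (firstCoeff k)) * ψ (xP k) := by
    intro P
    rw [firstP, map_sum, Finset.mul_sum]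
    refine Finset.sum_congr rfl fun k _ => ?_
    rw [map_mul, map_mul, Polynomial.aeval_C, mul_assoc, ← algebraMap_eq, AlgHom.commutes]
  have hfirstC : ∀ (P : Polynomial ℝ), ∀ μ ∈ eigFinset A B C D J,
      ∑ k, Polynomial.aeval μ (P * Polynomial.C (firstCoeff k)) *
        Polynomial.aeval μ (r (Sum.inl k)) = Polynomial.aeval μ P := by
    intro P μ hμ
    have := hr.evalCurve_firstP hgen hμ
    rw [firstP, map_sum] at this
    rw [← mul_one (Polynomial.aeval μ P), ← this, Finset.mul_sum]
    refine Finset.sum_congr rfl fun k _ => ?_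
    rw [map_mul, map_mul, Polynomial.aeval_C, mul_assoc, ← algebraMap_eq, AlgHom.commutes,
      evalCurve_xP]
  have hX : ∀ u, ψ (X (Sum.inl u)) = Polynomial.aeval (ψ lamP) (r u) * ψ firstP := by
    -- `y_u = ∑ k, c k x_k` on the solutions of the pattern `J`
    suffices H : ∀ (u : Fin n ⊕ Fin m) (c : Fin n → ℝ),
        ψ (X (Sum.inl u)) = ∑ k, algebraMap ℝ _ (c k) * ψ (xP k) →
        (∀ μ ∈ eigFinset A B C D J, Polynomial.aeval μ (r u) =
          ∑ k, (c k : ℂ) * Polynomial.aeval μ (r (Sum.inl k))) →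
        ψ (X (Sum.inl u)) = Polynomial.aeval (ψ lamP) (r u) * ψ firstP by
      rintro (i | j)
      · refine H (Sum.inl i) (Pi.single i 1) ?_ fun μ hμ => ?_
        · rw [Finset.sum_eq_single i]
          · simp [xP]
          · intro k _ hk
            simp [hk]
          · simp
        · rw [Finset.sum_eq_single i]
          · simp
          · intro k _ hk
            simp [hk]
          · simp
      · refine H (Sum.inr j) ((blockInv D J * C) j) ?_ fun μ hμ => ?_
        · refine (congrFun hW j).trans ?_
          rw [actVec_apply]
        · refine (congrFun (hr.lift J μ hμ) j).trans ?_
          rw [actVec_apply]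
          rfl
    intro u c h1 h2
    have := hr.sum_aeval_mul_eq_zero hgen hM
      (fun k => Polynomial.C (c k) - r u * Polynomial.C (firstCoeff k)) (fun μ hμ => by
        simp only [map_sub, sub_mul, Finset.sum_sub_distrib, hfirstC (r u) μ hμ, h2 μ hμ,
          Polynomial.aeval_C]
        exact sub_self _)
    simp only [map_sub, sub_mul, Finset.sum_sub_distrib, ← hfirst, Polynomial.aeval_C] at this
    rw [h1]
    exact sub_eq_zero.mp this
  let P : Polynomial ℝ := aeval (Sum.elim r fun _ => Polynomial.X) a
  have hP0 : Polynomial.aeval (ψ lamP) P * ψ firstP = 0 := by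
    rw [hfirst]
    refine hr.sum_aeval_mul_eq_zero hgen hM _ fun μ hμ => ?_
    rw [hfirstC P μ hμ]
    exact (aeval_aeval_elim μ a).trans (h0 μ hμ)
  refine Ideal.Quotient.eq_zero_iff_mem.mp ?_
  change ψ a = 0
  have hψ : ψ a = aeval (Sum.elim (fun u => Polynomial.aeval (ψ lamP) (r u) * ψ firstP)
      fun _ => ψ lamP) a := by
    refine DFunLike.congr_fun (algHom_ext ?_) a
    rintro (u | u)
    · simpa using hX u
    · simp [lamP]
  rw [hψ, ha.aeval_mul, ← aeval_aeval_elim, ← Nat.sub_add_cancel hl, pow_succ', ← mul_assoc, hP0,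
    zero_mul]

/-- A form in `(x, w)` of high degree that vanishes at all eigenvectors lies in the ideal of the
equations: it is a combination `∑ a_J g_J` with the separators `g_J` modulo this ideal, each `a_J`
vanishes at the eigenvectors of the pattern `J`, and `g_J` multiplies the ideal of `J` into the
ideal of the equations. -/
theorem exists_forall_rename_mem_eqIdeal (hr : IsEigCurve A B C D r) (hgen : IsGeneric A B C D)
    (hD : ‖Matrix.toEuclideanCLM (n := Fin m) (𝕜 := ℝ) D‖ < 1) :
    ∃ T, ∀ l ≥ T, ∀ g : MvPolynomial (Fin n ⊕ Fin m) ℝ, g.IsHomogeneous l →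
      (∀ μ ∈ allEigs A B C D, evalCurve r μ (rename Sum.inl g) = 0) →
      rename Sum.inl g ∈ eqIdeal A B C D := by
  obtain ⟨T, hT⟩ := Ideal.exists_pow_le_of_le_radical_of_fg
    (span_X_le_radical hD (isCoprime_charpoly hgen)) (Submodule.fg_span (Set.finite_range _))
  -- degree above `m` leaves a cofactor of positive degree beside each `g_J`, which has degree `m`
  refine ⟨T + m + 2, fun l hl g hg h0 => ?_⟩
  have hmem : (rename Sum.inl g : XWPoly n m) ∈
      Ideal.span (Set.range fun u : Fin n ⊕ Fin m => (X (Sum.inl u) : XWPoly n m)) ^ T := by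
    have h1 : g ∈ idealOfVars (Fin n ⊕ Fin m) ℝ ^ T := by
      rw [mem_pow_idealOfVars_iff]
      intro d hd
      have := hg.degree_eq_sum_deg_support hd
      change T ≤ ∑ i ∈ d.support, d i
      omega
    have h2 := Ideal.mem_map_of_mem (rename Sum.inl : _ →ₐ[ℝ] XWPoly n m) h1
    rw [Ideal.map_pow, idealOfVars, Ideal.map_span, ← Set.range_comp] at h2
    have e : (rename Sum.inl : _ →ₐ[ℝ] XWPoly n m) ∘ X =
        fun u : Fin n ⊕ Fin m => (X (Sum.inl u) : XWPoly n m) := funext fun u => by simp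
    rwa [e] at h2
  obtain ⟨a, ha, b, hb, hab⟩ := Submodule.mem_sup.mp (hT hmem)
  obtain ⟨p, q, rfl⟩ := mem_eqIdeal_iff.mp ha
  obtain ⟨c, rfl⟩ := Ideal.mem_span_range_iff_exists_fun.mp hb
  have hsplit : (rename Sum.inl g : XWPoly n m) =
      (∑ i, weightedHomogeneousComponent xwWeight (l - 1) (p i) * eigEq A B i +
        ∑ j, weightedHomogeneousComponent xwWeight (l - 2) (q j) * reluEq C D j) +
      ∑ J, weightedHomogeneousComponent xwWeight (l - m) (c J) * sepP C D J := by
    rw [← IsWeightedHomogeneous.weightedHomogeneousComponent_same (isXWHomogeneous_rename hg),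
      ← hab, map_add, map_add,
      eq_sum_weightedHomogeneousComponent_mul (δ := fun _ => 1) _
        (fun j _ => isXWHomogeneous_eigEq A B j) (fun _ _ => by omega),
      eq_sum_weightedHomogeneousComponent_mul (δ := fun _ => 2) _
        (fun j _ => isXWHomogeneous_reluEq C D j) (fun _ _ => by omega),
      eq_sum_weightedHomogeneousComponent_mul (δ := fun _ => m) _
        (fun J _ => isXWHomogeneous_sepP C D J) (fun _ _ => by omega)]
  have hI : ∑ i, weightedHomogeneousComponent xwWeight (l - 1) (p i) * eigEq A B i +
      ∑ j, weightedHomogeneousComponent xwWeight (l - 2) (q j) * reluEq C D j ∈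
        eqIdeal A B C D := mem_eqIdeal_iff.mpr ⟨_, _, rfl⟩
  rw [hsplit]
  refine add_mem hI (sum_mem fun J _ => sepP_mul_mem (mem_modeIdeal hr hgen hD
    (weightedHomogeneousComponent_isWeightedHomogeneous (l - m) (c J)) (by omega) fun μ hμ => ?_))
  have hμ' : μ ∈ allEigs A B C D := mem_allEigs.mpr ⟨J, hμ⟩
  have h1 := h0 μ hμ'
  rw [hsplit, map_add, hr.evalCurve_eq_zero_of_mem_eqIdeal hD hμ' hI, zero_add, map_sum,
    Finset.sum_eq_single J, map_mul, mul_eq_zero] at h1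
  · exact h1.resolve_right (hr.evalCurve_sepP_ne_zero hgen hD hμ)
  · intro J' _ hne
    rw [map_mul, hr.evalCurve_sepP_eq_zero hD hμ hne, mul_zero]
  · simp

theorem IsXWHomogeneous.totalDegree_le {p : XWPoly n m} {l L : ℕ} (hp : IsXWHomogeneous p l)
    (hL : degreeOf (Sum.inr ()) p ≤ L) : p.totalDegree ≤ l + L := by
  refine Finset.sup_le fun d hd => ?_
  have h1 := hp (mem_support_iff.mp hd)
  rw [degreeOf_eq_sup] at hL
  have h2 : d (Sum.inr PUnit.unit) ≤ L :=
    (Finset.le_sup (f := fun d : Var n m →₀ ℕ => d (Sum.inr ())) hd).trans hL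
  rw [Finsupp.weight_apply, Finsupp.sum_fintype _ _ (by simp)] at h1
  rw [Finsupp.sum_fintype _ _ (by simp), Fintype.sum_sum_type]
  simp only [xwWeight, Fintype.sum_sum_type, Sum.elim_inl, Sum.elim_inr] at h1 ⊢
  simp at h1 ⊢
  omega

/-- In high degree, a form vanishing at all eigenvectors is a combination of the equations, with
cofactors whose degrees obey the bounds of the relaxations. -/
theorem exists_forall_eq_sum_mul_eqs (hr : IsEigCurve A B C D r) (hgen : IsGeneric A B C D)
    (hD : ‖Matrix.toEuclideanCLM (n := Fin m) (𝕜 := ℝ) D‖ < 1) :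
    ∃ d₀ N₀ : ℕ, ∀ d ≥ d₀, ∀ N ≥ N₀, ∀ h : XWPoly n m, IsXWHomogeneous h (2 * d) →
      degreeOf (Sum.inr ()) h ≤ 2 * N → (∀ μ ∈ allEigs A B C D, evalCurve r μ h = 0) →
      ∃ (p : Fin n → XWPoly n m) (q : Fin m → XWPoly n m),
        (∀ i, IsXWHomogeneous (p i) (2 * d - 1) ∧ (p i).totalDegree ≤ 2 * N + 2 * d - 1) ∧
        (∀ j, IsXWHomogeneous (q j) (2 * d - 2) ∧ (q j).totalDegree ≤ 2 * N + 2 * d - 2) ∧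
        h = ∑ i, p i * eigEq A B i + ∑ j, q j * reluEq C D j := by
  obtain ⟨T, hT⟩ := exists_sub_rename_mem_truncIdeal A B C hD
  obtain ⟨T', hT'⟩ := exists_forall_rename_mem_eqIdeal hr hgen hD
  obtain ⟨L, hL⟩ := exists_mem_truncIdeal_of_mem_eqIdeal A B C D
  refine ⟨T + T' + 1, L, fun d hd N hN h hh hdeg h0 => ?_⟩
  obtain ⟨g, hg, hmem⟩ := hT (2 * d) (by omega) (2 * N) h hh hdeg
  have hgmem := hL g (hT' (2 * d) (by omega) g hg fun μ hμ => by
    have := hr.evalCurve_eq_zero_of_mem_eqIdeal hD hμ (truncIdeal_le_eqIdeal hmem)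
    rwa [map_sub, h0 μ hμ, zero_sub, neg_eq_zero] at this)
  have := add_mem hmem (truncIdeal_mono (show L ≤ 2 * N by omega) hgmem)
  rw [sub_add_cancel] at this
  obtain ⟨p, q, hp, hq, rfl⟩ := this
  have hp' := fun i => weightedHomogeneousComponent_isWeightedHomogeneous
    (w := xwWeight) (2 * d - 1) (p i)
  have hq' := fun j => weightedHomogeneousComponent_isWeightedHomogeneous
    (w := xwWeight) (2 * d - 2) (q j)
  refine ⟨_, _, fun i => ⟨hp' i, ?_⟩, fun j => ⟨hq' j, ?_⟩, ?_⟩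
  · have := IsXWHomogeneous.totalDegree_le (hp' i)
      ((degreeOf_weightedHomogeneousComponent_le _ _ _).trans (hp i))
    omega
  · have := IsXWHomogeneous.totalDegree_le (hq' j)
      ((degreeOf_weightedHomogeneousComponent_le _ _ _).trans (hq j))
    omega
  · conv_lhs => rw [← IsWeightedHomogeneous.weightedHomogeneousComponent_same hh]
    rw [map_add, eq_sum_weightedHomogeneousComponent_mul (δ := fun _ => 1) _
        (fun j _ => isXWHomogeneous_eigEq A B j) (fun _ _ => by omega),
      eq_sum_weightedHomogeneousComponent_mul (δ := fun _ => 2) _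
        (fun j _ => isXWHomogeneous_reluEq C D j) (fun _ _ => by omega)]

end Vanishing

/-! ### Moment functionals and weak duality -/

theorem rieszL_eq_sum (y : (Var n m →₀ ℕ) → ℝ) {p : XWPoly n m} {s : Finset (Var n m →₀ ℕ)}
    (hs : p.support ⊆ s) : rieszL y p = ∑ α ∈ s, p.coeff α * y α :=
  Finset.sum_subset hs fun α _ hα => by rw [notMem_support_iff.mp hα, zero_mul]

/-- The functional `L_y` as a linear map. -/
def rieszLin (y : (Var n m →₀ ℕ) → ℝ) : XWPoly n m →ₗ[ℝ] ℝ where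
  toFun := rieszL y
  map_add' p q := by
    classical
    rw [rieszL_eq_sum y (p := p + q) (s := p.support ∪ q.support) support_add,
      rieszL_eq_sum y (p := p) Finset.subset_union_left,
      rieszL_eq_sum y (p := q) Finset.subset_union_right, ← Finset.sum_add_distrib]
    exact Finset.sum_congr rfl fun α _ => by rw [coeff_add, add_mul]
  map_smul' c p := by
    rw [rieszL_eq_sum y (p := c • p) (s := p.support) support_smul, rieszL, RingHom.id_apply,
      smul_eq_mul, Finset.mul_sum]
    exact Finset.sum_congr rfl fun α _ => by rw [coeff_smul, smul_eq_mul, mul_assoc]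

theorem rieszLin_apply (y : (Var n m →₀ ℕ) → ℝ) (p : XWPoly n m) :
    rieszLin y p = rieszL y p := rfl

theorem rieszL_sum_mul_sum {κ : Type*} [Fintype κ] {N : ℕ} (y : (Var n m →₀ ℕ) → ℝ)
    (h : XWPoly n m) (k : ℕ) (c : BIdx n m N → ℝ) (b' : κ → XWPoly n m) (c' : κ → ℝ) :
    rieszL y (normSqP ^ k * h * (∑ b, c b • bMon b) * (∑ b, c' b • b' b)) =
      ∑ b, ∑ b₁, c b * c' b₁ * rieszL y (normSqP ^ k * h * bMon b * b' b₁) := by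
  simp only [← rieszLin_apply, Finset.mul_sum, Finset.sum_mul, map_sum, mul_smul_comm,
    smul_mul_assoc, map_smul, smul_eq_mul]
  rw [Finset.sum_comm]
  exact Finset.sum_congr rfl fun b _ => Finset.sum_congr rfl fun b₁ _ => by ring

theorem rieszL_mul_sos_nonneg {y : (Var n m →₀ ℕ) → ℝ} {h : XWPoly n m} {k N : ℕ}
    (hpsd : (locMatrix y h k N).PosSemidef) {σ : XWPoly n m} (hσ : IsSosOn N σ) :
    0 ≤ rieszL y (normSqP ^ k * h * σ) := by
  obtain ⟨l, v, hv, rfl⟩ := hσ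
  rw [← rieszLin_apply, Finset.mul_sum, map_sum]
  refine Finset.sum_nonneg fun i _ => ?_
  obtain ⟨c, hc⟩ := (Submodule.mem_span_range_iff_exists_fun ℝ).mp (hv i)
  have := hpsd.dotProduct_mulVec_nonneg c
  rw [rieszLin_apply, sq, ← mul_assoc, ← hc, rieszL_sum_mul_sum]
  convert this using 1
  simp only [dotProduct, Matrix.mulVec, star_trivial, Finset.mul_sum, locMatrix, Matrix.of_apply]
  exact Finset.sum_congr rfl fun b _ => Finset.sum_congr rfl fun b₁ _ => by ring

section Duality

variable {A : Matrix (Fin n) (Fin n) ℝ} {B : Matrix (Fin n) (Fin m) ℝ}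
    {C : Matrix (Fin m) (Fin n) ℝ} {D : Matrix (Fin m) (Fin m) ℝ}

theorem le_rieszL_of_sosFeasible {f : XWPoly n m} {d N : ℕ} (hd : 1 ≤ d) {ρ : ℝ}
    (hρ : SosFeasible A B C D f d N ρ) {y : (Var n m →₀ ℕ) → ℝ} (hy : MomFeasible A B C D d N y) :
    ρ ≤ rieszL y (normSqP ^ (d - 1) * f) := by
  obtain ⟨σ₀, σlam, σ, p, q, h0, hl, hg, hp, hq, h⟩ := hρ
  have h1 : (normSqP ^ (d - 1) * (f - MvPolynomial.C ρ * normSqP) : XWPoly n m) =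
      normSqP ^ (d - 1) * f - ρ • normSqP ^ d := by
    rw [smul_eq_C_mul, ← Nat.sub_add_cancel hd, pow_succ, Nat.add_sub_cancel]
    ring
  rw [h1, Finset.mul_sum, mul_add] at h
  have h2 := congrArg (rieszLin y) h
  simp only [map_sub, map_add, map_sum, map_smul, rieszLin_apply, hy.norm_eq, smul_eq_mul,
    mul_one] at h2
  have e1 : 0 ≤ rieszL y (normSqP ^ (d - 1) * σ₀) := by
    simpa using rieszL_mul_sos_nonneg hy.hankel_psd h0
  have e2 : 0 ≤ rieszL y (normSqP ^ (d - 1) * (lamP * σlam)) := by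
    simpa [mul_assoc] using rieszL_mul_sos_nonneg hy.lam_psd hl
  have e3 : 0 ≤ ∑ g ∈ ineqSet C D, rieszL y (normSqP ^ (d - 2) * (g * σ g)) :=
    Finset.sum_nonneg fun g hgm => by
      simpa [mul_assoc] using rieszL_mul_sos_nonneg (hy.ineq_psd g hgm) (hg g hgm)
  have e4 : ∑ i, rieszL y (p i * eigEq A B i) = 0 :=
    Finset.sum_eq_zero fun i _ => hy.eig_eq _ (hp i).1 (hp i).2 i
  have e5 : ∑ j, rieszL y (q j * reluEq C D j) = 0 :=
    Finset.sum_eq_zero fun j _ => hy.relu_eq _ (hq j).1 (hq j).2 j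
  linarith

theorem sosValue_le_momValue (f : XWPoly n m) {d : ℕ} (hd : 1 ≤ d) (N : ℕ) :
    sosValue A B C D f d N ≤ momValue A B C D f d N := by
  refine sSup_le ?_
  rintro _ ⟨ρ, hρ, rfl⟩
  refine le_sInf ?_
  rintro _ ⟨y, hy, rfl⟩
  exact EReal.coe_le_coe_iff.mpr (le_rieszL_of_sosFeasible hd hρ hy)

theorem rieszL_pointEval (a : Var n m → ℝ) (p : XWPoly n m) :
    rieszL (fun α => α.prod fun u k => a u ^ k) p = eval a p := by
  rw [rieszL, eval_eq]
  rfl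

theorem posSemidef_locMatrix_pointEval (a : Var n m → ℝ) {h : XWPoly n m} (k N : ℕ)
    (hpos : 0 ≤ eval a (normSqP ^ k * h)) :
    (locMatrix (fun α => α.prod fun u k => a u ^ k) h k N).PosSemidef := by
  have : locMatrix (fun α => α.prod fun u k => a u ^ k) h k N =
      eval a (normSqP ^ k * h) • Matrix.vecMulVec (fun b : BIdx n m N => eval a (bMon b))
        (star fun b : BIdx n m N => eval a (bMon b)) := by
    ext b b'
    simp only [locMatrix, Matrix.of_apply, rieszL_pointEval, map_mul, Matrix.smul_apply,
      Matrix.vecMulVec_apply, star_trivial, smul_eq_mul]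
    ring
  rw [this]
  exact (Matrix.posSemidef_vecMulVec_self_star _).smul hpos

theorem momFeasible_pointEval {a : Var n m → ℝ} (ha : a ∈ feasSet A B C D) (d N : ℕ) :
    MomFeasible A B C D d N fun α => α.prod fun u k => a u ^ k := by
  obtain ⟨he, hr, hn, hl, hg⟩ := ha
  have hn' : eval a (normSqP : XWPoly n m) = 1 := sub_eq_zero.mp hn
  refine ⟨?_, ?_, fun g hgm => ?_, fun p _ _ i => ?_, fun q _ _ j => ?_, ?_⟩
  · exact posSemidef_locMatrix_pointEval a _ _ (by simp [hn'])
  · exact posSemidef_locMatrix_pointEval a _ _ (by simpa [hn'] using hl)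
  · exact posSemidef_locMatrix_pointEval a _ _ (by simpa [hn'] using hg g hgm)
  · rw [rieszL_pointEval, map_mul, he, mul_zero]
  · rw [rieszL_pointEval, map_mul, hr, mul_zero]
  · rw [rieszL_pointEval, map_pow, hn', one_pow]

theorem momValue_le_minValue (f : XWPoly n m) (d N : ℕ) :
    momValue A B C D f d N ≤ minValue A B C D f := by
  refine le_sInf ?_
  rintro _ ⟨a, ha, rfl⟩
  refine sInf_le ⟨_, momFeasible_pointEval ha d N, ?_⟩
  rw [rieszL_pointEval, map_mul, map_pow, sub_eq_zero.mp ha.2.2.1, one_pow, one_mul]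

end Duality

/-! ### Bidegrees -/

/-- `p` is homogeneous of degree `l` in `(x, w)` and of degree at most `L` in `λ`. -/
def IsBiform (p : XWPoly n m) (l L : ℕ) : Prop :=
  IsXWHomogeneous p l ∧ degreeOf (Sum.inr ()) p ≤ L

namespace IsBiform

variable {p q : XWPoly n m} {l l' L L' : ℕ}

theorem mono (hp : IsBiform p l L) (h : L ≤ L') : IsBiform p l L' := ⟨hp.1, hp.2.trans h⟩

theorem add (hp : IsBiform p l L) (hq : IsBiform q l L) : IsBiform (p + q) l L :=
  ⟨hp.1.add hq.1, (degreeOf_add_le _ _ _).trans (max_le hp.2 hq.2)⟩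

theorem mul (hp : IsBiform p l L) (hq : IsBiform q l' L') : IsBiform (p * q) (l + l') (L + L') :=
  ⟨hp.1.mul hq.1, (degreeOf_mul_le _ _ _).trans (add_le_add hp.2 hq.2)⟩

theorem pow (hp : IsBiform p l L) (k : ℕ) : IsBiform (p ^ k) (k * l) (k * L) :=
  ⟨by simpa using! IsWeightedHomogeneous.pow hp.1 k,
    (degreeOf_pow_le _ _ _).trans (Nat.mul_le_mul_left _ hp.2)⟩

theorem C (c : ℝ) : IsBiform (MvPolynomial.C c : XWPoly n m) 0 0 :=
  ⟨isWeightedHomogeneous_C _ _, (degreeOf_C _ _).le⟩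

theorem neg (hp : IsBiform p l L) : IsBiform (-p) l L :=
  ⟨hp.1.neg, by rw [degreeOf_neg]; exact hp.2⟩

theorem sub (hp : IsBiform p l L) (hq : IsBiform q l L) : IsBiform (p - q) l L := by
  rw [sub_eq_add_neg]
  exact hp.add hq.neg

theorem sum {κ : Type*} (s : Finset κ) {p : κ → XWPoly n m} (hp : ∀ i ∈ s, IsBiform (p i) l L) :
    IsBiform (∑ i ∈ s, p i) l L :=
  ⟨IsWeightedHomogeneous.sum _ _ _ fun i hi => (hp i hi).1,
    (degreeOf_sum_le _ _ _).trans (Finset.sup_le fun i hi => (hp i hi).2)⟩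

theorem xP (i : Fin n) : IsBiform (xP i : XWPoly n m) 1 0 :=
  ⟨isXWHomogeneous_xP i, (degreeOf_X_of_ne (by simp)).le⟩

theorem wP (j : Fin m) : IsBiform (wP j : XWPoly n m) 1 0 :=
  ⟨isXWHomogeneous_wP j, (degreeOf_X_of_ne (by simp)).le⟩

theorem lamP : IsBiform (lamP : XWPoly n m) 0 1 :=
  ⟨isXWHomogeneous_lamP, (degreeOf_X_self _).le⟩

theorem normSqP : IsBiform (normSqP : XWPoly n m) 2 0 :=
  (sum _ fun i _ => (xP i).pow 2).add (sum _ fun j _ => (wP j).pow 2)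

theorem affP (C : Matrix (Fin m) (Fin n) ℝ) (D : Matrix (Fin m) (Fin m) ℝ) (j : Fin m) :
    IsBiform (affP C D j) 1 0 :=
  (sum _ fun i _ => by simpa using (IsBiform.C _).mul (xP i)).add
    (sum _ fun k _ => by simpa using (IsBiform.C _).mul (wP k))

theorem of_mem_ineqSet {C : Matrix (Fin m) (Fin n) ℝ} {D : Matrix (Fin m) (Fin m) ℝ}
    {g : XWPoly n m} (hg : g ∈ ineqSet C D) : IsBiform g 2 0 := by
  simp only [ineqSet, Finset.mem_union, Finset.mem_image, Finset.mem_univ, true_and] at hg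
  obtain (⟨k, rfl⟩ | ⟨k, rfl⟩) | ⟨k, rfl⟩ := hg
  · exact (wP _).mul (wP _)
  · exact ((wP _).mul (wP _)).sub ((wP _).mul (affP C D _))
  · exact ((wP _).sub (affP C D _)).mul ((wP _).sub (affP C D _))

theorem bMon {N : ℕ} (b : BIdx n m N) : IsBiform (bMon b : XWPoly n m) 1 N := by
  have h : IsBiform (X (Sum.inl b.2) : XWPoly n m) 1 0 :=
    ⟨isWeightedHomogeneous_X ℝ xwWeight _, (degreeOf_X_of_ne (by simp)).le⟩
  have := (lamP.pow (b.1 : ℕ)).mul h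
  simp only [mul_zero, zero_add, mul_one, add_zero] at this
  exact this.mono (Nat.lt_succ_iff.mp b.1.2)

theorem of_mem_span {N : ℕ}
    (hp : p ∈ Submodule.span ℝ (Set.range (SparseHierarchy.bMon (n := n) (m := m) (N := N)))) :
    IsBiform p 1 N := by
  obtain ⟨c, rfl⟩ := (Submodule.mem_span_range_iff_exists_fun ℝ).mp hp
  refine sum _ fun b _ => ?_
  rw [smul_eq_C_mul]
  simpa using (C (c b)).mul (bMon b)

end IsBiform

theorem isSosOn_sq {N : ℕ} {p : XWPoly n m}
    (hp : p ∈ Submodule.span ℝ (Set.range (bMon (n := n) (m := m) (N := N)))) :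
    IsSosOn N (p ^ 2) :=
  ⟨1, fun _ => p, fun _ => hp, by simp⟩

/-! ### Interpolation by polynomials supported on the monomial basis -/

section Interpolation

open scoped ComplexConjugate

variable {A : Matrix (Fin n) (Fin n) ℝ} {B : Matrix (Fin n) (Fin m) ℝ}
    {C : Matrix (Fin m) (Fin n) ℝ} {D : Matrix (Fin m) (Fin m) ℝ}
    {r : Fin n ⊕ Fin m → Polynomial ℝ}

theorem lamP_pow_mul_firstP_mem_span {N k : ℕ} (hk : k ≤ N) :
    lamP ^ k * firstP ∈ Submodule.span ℝ (Set.range (bMon (n := n) (m := m) (N := N))) := by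
  rw [firstP, Finset.mul_sum]
  refine sum_mem fun i _ => ?_
  rw [mul_left_comm, ← smul_eq_C_mul]
  exact Submodule.smul_mem _ _
    (Submodule.subset_span ⟨(⟨k, Nat.lt_succ_of_le hk⟩, Sum.inl i), rfl⟩)

/-- As the first coordinate of the eigenvectors is `1` and the eigenvalues are distinct, the
polynomials `P(λ) x_1` take all values that are compatible with conjugation. -/
theorem IsEigCurve.exists_mem_span_evalCurve_eq (hr : IsEigCurve A B C D r)
    (hgen : IsGeneric A B C D) {N : ℕ} (hN : (allEigs A B C D).card ≤ N + 1) (v : ℂ → ℂ)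
    (hv : ∀ μ, v (conj μ) = conj (v μ)) :
    ∃ p ∈ Submodule.span ℝ (Set.range (bMon (n := n) (m := m) (N := N))),
      ∀ μ ∈ allEigs A B C D, evalCurve r μ p = v μ := by
  obtain ⟨P, hdeg, hP⟩ := exists_real_interpolant (allEigs A B C D)
    (fun _ h => conj_mem_allEigs h) v
  refine ⟨∑ k ∈ Finset.range (allEigs A B C D).card, P.coeff k • (lamP ^ k * firstP),
    sum_mem fun k hk => Submodule.smul_mem _ _ (lamP_pow_mul_firstP_mem_span ?_), fun μ hμ => ?_⟩
  · have := Finset.mem_range.mp hk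
    omega
  · obtain ⟨J, hJ⟩ := mem_allEigs.mp hμ
    have hnat : P.natDegree < (allEigs A B C D).card := by
      by_cases h0 : P = 0
      · rw [h0, Polynomial.natDegree_zero]
        exact Finset.card_pos.mpr ⟨μ, hμ⟩
      · exact (Polynomial.natDegree_lt_iff_degree_lt h0).mpr hdeg
    have h := hP μ hμ
    rw [hv, Complex.conj_conj, add_self_div_two, Polynomial.aeval_eq_sum_range' hnat] at h
    rw [← h, map_sum]
    refine Finset.sum_congr rfl fun k _ => ?_
    rw [map_smul, map_mul, map_pow, evalCurve_lamP, hr.evalCurve_firstP hgen hJ, mul_one]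

theorem evalCurve_conj (r : Fin n ⊕ Fin m → Polynomial ℝ) (μ : ℂ) (p : XWPoly n m) :
    evalCurve r (conj μ) p = conj (evalCurve r μ p) := by
  refine DFunLike.congr_fun (f := evalCurve r (conj μ))
    (g := (Complex.conjAe : ℂ →ₐ[ℝ] ℂ).comp (evalCurve r μ)) (algHom_ext ?_) p
  rintro (u | u)
  · simp [Polynomial.aeval_conj]
  · simp [evalCurve]

/-- The real point of the eigenvector curve over a real number `t`. -/
def realPt (r : Fin n ⊕ Fin m → Polynomial ℝ) (t : ℝ) : Var n m → ℝ :=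
  Sum.elim (fun u => (r u).eval t) fun _ => t

theorem evalCurve_ofReal (r : Fin n ⊕ Fin m → Polynomial ℝ) (t : ℝ) (p : XWPoly n m) :
    evalCurve r (t : ℂ) p = ((eval (realPt r t) p : ℝ) : ℂ) := by
  have h : (Sum.elim (fun u => Polynomial.aeval (t : ℂ) (r u)) fun _ => (t : ℂ)) =
      algebraMap ℝ ℂ ∘ realPt r t := by
    ext (u | u)
    · exact Polynomial.aeval_algebraMap_apply ℂ t (r u)
    · rfl
  rw [evalCurve, h, aeval_algebraMap_apply]
  rfl

theorem IsXWHomogeneous.eval_mul {p : XWPoly n m} {l : ℕ} (hp : IsXWHomogeneous p l)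
    (g : Fin n ⊕ Fin m → ℝ) (c t : ℝ) :
    eval (Sum.elim (fun u => g u * c) fun _ => t) p = eval (Sum.elim g fun _ => t) p * c ^ l :=
  hp.aeval_mul g c t

theorem eval_normSqP_pos (hr : IsEigCurve A B C D r) (hgen : IsGeneric A B C D) {t : ℝ}
    (ht : (t : ℂ) ∈ allEigs A B C D) : 0 < eval (realPt r t) (normSqP : XWPoly n m) := by
  obtain ⟨J, hJ⟩ := mem_allEigs.mp ht
  have hn := pos_of_mem_eigFinset hgen hJ
  have h1 : (r (Sum.inl ⟨0, hn⟩)).eval t = 1 := by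
    have : (((r (Sum.inl ⟨0, hn⟩)).eval t : ℝ) : ℂ) = 1 :=
      (Polynomial.aeval_algebraMap_apply ℂ t _).symm.trans (hr.first J _ hJ ⟨0, hn⟩ rfl)
    exact_mod_cast this
  have h2 := Finset.single_le_sum (f := fun i : Fin n => (r (Sum.inl i)).eval t ^ 2)
    (fun _ _ => sq_nonneg _) (Finset.mem_univ ⟨0, hn⟩)
  have h3 : 0 ≤ ∑ j : Fin m, (r (Sum.inr j)).eval t ^ 2 := Finset.sum_nonneg fun _ _ => sq_nonneg _
  simp only [h1] at h2
  simp only [normSqP, xP, wP, map_add, map_sum, map_pow, eval_X, realPt, Sum.elim_inl]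
  linarith

/-- Rescaled to norm `1`, a real point of the eigenvector curve over an eigenvalue is feasible as
soon as it satisfies the inequalities. -/
theorem eval_sub_nonneg_of_feasible (hr : IsEigCurve A B C D r) (hgen : IsGeneric A B C D)
    (hD : ‖Matrix.toEuclideanCLM (n := Fin m) (𝕜 := ℝ) D‖ < 1) {f : XWPoly n m}
    (hf : IsXWHomogeneous f 2) {ρ : ℝ} (hρ : ∀ a ∈ feasSet A B C D, ρ ≤ eval a f) {t : ℝ}
    (ht : (t : ℂ) ∈ allEigs A B C D) (ht0 : 0 ≤ t)
    (hg : ∀ g ∈ ineqSet C D, 0 ≤ eval (realPt r t) g) :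
    0 ≤ eval (realPt r t) (f - MvPolynomial.C ρ * normSqP) := by
  have hq := eval_normSqP_pos hr hgen ht
  set q := eval (realPt r t) (normSqP : XWPoly n m) with hqdef
  let a : Var n m → ℝ := Sum.elim (fun u => (r u).eval t * (√q)⁻¹) fun _ => t
  have ha : ∀ {p : XWPoly n m} {l : ℕ}, IsXWHomogeneous p l →
      eval a p = eval (realPt r t) p * (√q)⁻¹ ^ l := fun hp => hp.eval_mul _ _ _
  have hsq : (√q)⁻¹ ^ 2 = q⁻¹ := by rw [inv_pow, Real.sq_sqrt hq.le]
  have hzero : ∀ {p : XWPoly n m}, p ∈ eqIdeal A B C D → eval (realPt r t) p = 0 := fun hp => by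
    have := hr.evalCurve_eq_zero_of_mem_eqIdeal hD ht hp
    rw [evalCurve_ofReal] at this
    exact_mod_cast this
  have hmem : a ∈ feasSet A B C D := by
    refine ⟨fun i => ?_, fun j => ?_, ?_, ?_, fun g hgm => ?_⟩
    · rw [ha (isXWHomogeneous_eigEq A B i), hzero (eigEq_mem_eqIdeal i), zero_mul]
    · rw [ha (isXWHomogeneous_reluEq C D j), hzero (reluEq_mem_eqIdeal j), zero_mul]
    · rw [ha IsBiform.normSqP.1, hsq, ← hqdef, mul_inv_cancel₀ hq.ne', sub_self]
    · simpa [a, lamP] using ht0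
    · rw [ha (IsBiform.of_mem_ineqSet hgm).1, hsq]
      exact mul_nonneg (hg g hgm) (inv_nonneg.mpr hq.le)
  have := hρ a hmem
  rw [ha hf, hsq, ← div_eq_mul_inv, le_div_iff₀ hq] at this
  rw [map_sub, map_mul, eval_C]
  exact sub_nonneg.mpr this

/-- A square root compatible with conjugation, which is set to `0` where the value is real and
negative. -/
theorem exists_conj_sqrt (c : ℂ → ℂ) (hc : ∀ μ, c (conj μ) = conj (c μ)) :
    ∃ v : ℂ → ℂ, (∀ μ, v (conj μ) = conj (v μ)) ∧ (∀ μ, μ.im ≠ 0 → v μ ^ 2 = c μ) ∧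
      (∀ t : ℝ, 0 ≤ (c t).re → v t ^ 2 = c t) ∧ ∀ t : ℝ, (c t).re < 0 → v t = 0 := by
  choose root hroot using fun z : ℂ => IsAlgClosed.exists_pow_nat_eq z (n := 2) two_pos
  let v : ℂ → ℂ := fun μ => if 0 < μ.im then root (c μ) else
    if μ.im < 0 then conj (root (c (conj μ))) else
    if 0 ≤ (c μ).re then ((√(c μ).re : ℝ) : ℂ) else 0
  refine ⟨v, fun μ => ?_, fun μ hμ => ?_, fun t ht => ?_, fun t ht => ?_⟩
  · rcases lt_trichotomy μ.im 0 with h | h | h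
    · have h' : ¬ 0 < μ.im := h.not_gt
      simp [v, h, h']
    · rw [Complex.conj_eq_iff_im.mpr h]
      simp only [v, h, lt_irrefl, if_false]
      split_ifs <;> simp
    · have h' : ¬ μ.im < 0 := h.not_gt
      simp [v, h, h']
  · rcases lt_or_gt_of_ne hμ with h | h
    · simp only [v, h, h.not_gt, if_true, if_false]
      rw [← map_pow, hroot, hc, Complex.conj_conj]
    · simp only [v, h, if_true]
      exact hroot _
  · have him : (c t).im = 0 := by
      rw [← Complex.conj_eq_iff_im, ← hc, Complex.conj_ofReal]
    simp only [v, Complex.ofReal_im, lt_irrefl, if_false, ht, if_true]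
    rw [← Complex.ofReal_pow, Real.sq_sqrt ht]
    exact Complex.ext rfl him.symm
  · simp [v, ht.not_ge]

/-! ### The certificates -/

/-- Every lower bound `ρ` of `f` on the feasible set has a certificate. At a nonreal eigenvalue, and
where `f - ρ ‖(x, w)‖²` is nonnegative, its value is that of a square; at a remaining negative
eigenvalue it is `λ` times a square, and at the other infeasible points it is a square times an
inequality that fails there. Each kind of square is obtained by interpolation. -/
theorem exists_forall_sosFeasible (hgen : IsGeneric A B C D)
    (hD : ‖Matrix.toEuclideanCLM (n := Fin m) (𝕜 := ℝ) D‖ < 1) {f : XWPoly n m}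
    (hf : IsXWHomogeneous f 2) :
    ∃ d₀ N₀ : ℕ, ∀ d ≥ d₀, ∀ N ≥ N₀, ∀ ρ : ℝ, (∀ a ∈ feasSet A B C D, ρ ≤ eval a f) →
      SosFeasible A B C D f d N ρ := by
  classical
  obtain ⟨r, hr⟩ := exists_isEigCurve hgen
  obtain ⟨d₀, N₀, hkey⟩ := exists_forall_eq_sum_mul_eqs hr hgen hD
  refine ⟨d₀ + 2, N₀ + (allEigs A B C D).card + degreeOf (Sum.inr ()) f + 1,
    fun d hd N hN ρ hρ => ?_⟩
  let P : XWPoly n m := f - MvPolynomial.C ρ * normSqP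
  obtain ⟨v₀, hv₀conj, hv₀im, hv₀pos, hv₀neg⟩ :=
    exists_conj_sqrt (fun μ => evalCurve r μ P) (fun μ => evalCurve_conj r μ P)
  simp only [evalCurve_ofReal, Complex.ofReal_re] at hv₀pos hv₀neg
  -- an inequality that fails at a given infeasible point
  have hex : ∀ t : ℝ, ∃ g : XWPoly n m, (t : ℂ) ∈ allEigs A B C D → 0 ≤ t →
      eval (realPt r t) P < 0 → g ∈ ineqSet C D ∧ eval (realPt r t) g < 0 := by
    intro t
    by_cases h : (t : ℂ) ∈ allEigs A B C D ∧ 0 ≤ t ∧ eval (realPt r t) P < 0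
    · obtain ⟨h1, h2, h3⟩ := h
      by_contra! hcon
      refine h3.not_ge (eval_sub_nonneg_of_feasible hr hgen hD hf hρ h1 h2 fun g hg => ?_)
      exact (hcon g).2.2.2 hg
    · exact ⟨0, fun h1 h2 h3 => absurd ⟨h1, h2, h3⟩ h⟩
  choose γ hγ using hex
  let φlam : ℝ → ℝ := fun t => if eval (realPt r t) P < 0 ∧ t < 0 then
    √(eval (realPt r t) P / t) else 0
  let φ : XWPoly n m → ℝ → ℝ := fun g t => if eval (realPt r t) P < 0 ∧ 0 ≤ t ∧ γ t = g then
    √(eval (realPt r t) normSqP * eval (realPt r t) P / eval (realPt r t) g) else 0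
  -- functions supported on the real eigenvalues are compatible with conjugation
  have hreal : ∀ (φ : ℝ → ℝ) (μ : ℂ),
      (if (conj μ).im = 0 then ((φ (conj μ).re : ℝ) : ℂ) else 0) =
        conj (if μ.im = 0 then ((φ μ.re : ℝ) : ℂ) else 0) := by
    intro φ μ
    simp only [Complex.conj_im, Complex.conj_re, neg_eq_zero]
    split_ifs <;> simp
  obtain ⟨p₀, hp₀, hp₀v⟩ := hr.exists_mem_span_evalCurve_eq hgen (N := N) (by omega) v₀ hv₀conj
  obtain ⟨pl, hpl, hplv⟩ := hr.exists_mem_span_evalCurve_eq hgen (N := N - 1) (by omega)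
    (fun μ => if μ.im = 0 then ((φlam μ.re : ℝ) : ℂ) else 0) (hreal φlam)
  choose pg hpg hpgv using fun g => hr.exists_mem_span_evalCurve_eq hgen (N := N) (by omega)
    (fun μ => if μ.im = 0 then ((φ g μ.re : ℝ) : ℂ) else 0) (hreal (φ g))
  have hval : ∀ μ ∈ allEigs A B C D, evalCurve r μ normSqP * evalCurve r μ P =
      evalCurve r μ normSqP * (v₀ μ ^ 2 + μ * evalCurve r μ pl ^ 2) +
        ∑ g ∈ ineqSet C D, evalCurve r μ g * evalCurve r μ (pg g) ^ 2 := by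
    intro μ hμ
    simp only [hplv μ hμ, hpgv _ μ hμ]
    by_cases him : μ.im = 0
    · obtain ⟨t, rfl⟩ : ∃ t : ℝ, μ = t := ⟨μ.re, Complex.ext rfl (by simpa using him)⟩
      simp only [Complex.ofReal_im, if_true, Complex.ofReal_re]
      by_cases hpos : 0 ≤ eval (realPt r t) P
      · rw [hv₀pos t hpos]
        simp [φlam, φ, hpos.not_gt, evalCurve_ofReal]
      · rw [not_le] at hpos
        rw [hv₀neg t hpos]
        by_cases ht : t < 0
        · have : ((φlam t : ℝ) : ℂ) ^ 2 = ((eval (realPt r t) P / t : ℝ) : ℂ) := by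
            rw [← Complex.ofReal_pow]
            simp only [φlam, hpos, ht, and_self, if_true]
            rw [Real.sq_sqrt (div_nonneg_of_nonpos hpos.le ht.le)]
          rw [this, evalCurve_ofReal, evalCurve_ofReal]
          have ht' : (t : ℂ) ≠ 0 := by exact_mod_cast ht.ne
          simp [φ, ht.not_ge, mul_div_cancel₀ _ ht']
        · rw [not_lt] at ht
          obtain ⟨hgm, hgneg⟩ := hγ t hμ ht hpos
          have hz : φlam t = 0 := by simp [φlam, ht.not_gt]
          have : ((φ (γ t) t : ℝ) : ℂ) ^ 2 = ((eval (realPt r t) normSqP *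
              eval (realPt r t) P / eval (realPt r t) (γ t) : ℝ) : ℂ) := by
            rw [← Complex.ofReal_pow]
            simp only [φ, hpos, ht, and_self, if_true]
            rw [Real.sq_sqrt (div_nonneg_of_nonpos (mul_nonpos_of_nonneg_of_nonpos
              (eval_normSqP_pos hr hgen hμ).le hpos.le) hgneg.le)]
          rw [Finset.sum_eq_single (γ t), this, hz, evalCurve_ofReal, evalCurve_ofReal,
            evalCurve_ofReal]
          · have hg' : ((eval (realPt r t) (γ t) : ℝ) : ℂ) ≠ 0 := by exact_mod_cast hgneg.ne
            push_cast
            rw [mul_div_cancel₀ _ hg']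
            simp
          · intro g _ hne
            simp [φ, hne.symm]
          · exact fun h => absurd hgm h
    · simp [him, hv₀im μ him]
  let h : XWPoly n m := normSqP ^ (d - 1) * P - normSqP ^ (d - 1) * (p₀ ^ 2 + lamP * pl ^ 2) -
    normSqP ^ (d - 2) * ∑ g ∈ ineqSet C D, g * pg g ^ 2
  have hbi : IsBiform h (2 * d) (2 * N) := by
    have hP : IsBiform P 2 (2 * N) := by
      refine IsBiform.sub ⟨hf, by omega⟩ ?_
      have := (IsBiform.C ρ).mul (IsBiform.normSqP (n := n) (m := m))
      simp only [zero_add] at this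
      exact this.mono (Nat.zero_le _)
    have h₀ : IsBiform (p₀ ^ 2 + lamP * pl ^ 2) 2 (2 * N) := by
      refine ((IsBiform.of_mem_span hp₀).pow 2).add ?_
      have := IsBiform.lamP.mul ((IsBiform.of_mem_span hpl).pow 2)
      simp only [zero_add] at this
      exact this.mono (by omega)
    have hg : IsBiform (∑ g ∈ ineqSet C D, g * pg g ^ 2) 4 (2 * N) := by
      refine IsBiform.sum _ fun g hg => ?_
      have := (IsBiform.of_mem_ineqSet hg).mul ((IsBiform.of_mem_span (hpg g)).pow 2)
      simpa using this
    have e1 := (IsBiform.normSqP.pow (d - 1)).mul hP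
    have e2 := (IsBiform.normSqP.pow (d - 1)).mul h₀
    have e3 := (IsBiform.normSqP.pow (d - 2)).mul hg
    rw [show (d - 1) * 2 + 2 = 2 * d by omega, mul_zero, zero_add] at e1 e2
    rw [show (d - 2) * 2 + 4 = 2 * d by omega, mul_zero, zero_add] at e3
    exact (e1.sub e2).sub e3
  have hvan : ∀ μ ∈ allEigs A B C D, evalCurve r μ h = 0 := by
    intro μ hμ
    have hd' : d - 1 = (d - 2) + 1 := by omega
    simp only [h, map_sub, map_mul, map_add, map_sum, map_pow, evalCurve_lamP, hp₀v μ hμ]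
    rw [hd', pow_succ, mul_assoc, hval μ hμ]
    ring
  obtain ⟨p, q, hp, hq, hpq⟩ := hkey d (by omega) N (by omega) h hbi.1 hbi.2 hvan
  refine ⟨p₀ ^ 2, pl ^ 2, fun g => pg g ^ 2, p, q, isSosOn_sq hp₀, isSosOn_sq hpl,
    fun g _ => isSosOn_sq (hpg g), hp, hq, ?_⟩
  rw [add_assoc _ (∑ i, p i * eigEq A B i), ← hpq]
  simp only [h, P]
  ring

theorem minValue_le_sosValue {f : XWPoly n m} {d N : ℕ}
    (h : ∀ ρ : ℝ, (∀ a ∈ feasSet A B C D, ρ ≤ eval a f) → SosFeasible A B C D f d N ρ) :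
    minValue A B C D f ≤ sosValue A B C D f d N := by
  refine le_of_forall_lt fun c hc => ?_
  obtain ⟨ρ, h1, h2⟩ := EReal.exists_between_coe_real hc
  refine h1.trans_le (le_sSup ⟨ρ, h ρ fun a ha => ?_, rfl⟩)
  exact EReal.coe_le_coe_iff.mp (h2.le.trans (sInf_le ⟨a, ha, rfl⟩))

/-! ### Flat extension of the Hankel matrices -/

/-- If a functional depends only on the values at the eigenvectors, then the rank of its Hankel
matrix does not increase when monomials are replaced by polynomials with the same values. -/
theorem rank_hankel_le {y : (Var n m →₀ ℕ) → ℝ} {d N N₁ N₂ : ℕ} (hd : 1 ≤ d)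
    (hy : ∀ h : XWPoly n m, IsBiform h (2 * d) (2 * N) →
      (∀ μ ∈ allEigs A B C D, evalCurve r μ h = 0) → rieszL y h = 0)
    (h₁ : N₁ ≤ N) (h₂ : N₂ ≤ N)
    (hb : ∀ b : BIdx n m N₁, ∃ p ∈ Submodule.span ℝ (Set.range (bMon (n := n) (m := m) (N := N₂))),
      ∀ μ ∈ allEigs A B C D, evalCurve r μ p = evalCurve r μ (bMon b)) :
    (hankel y d N₁).rank ≤ (hankel y d N₂).rank := by
  choose p hp hpv using hb
  choose T hT using fun b => (Submodule.mem_span_range_iff_exists_fun ℝ).mp (hp b)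
  have key : hankel y d N₁ = Matrix.of T * hankel y d N₂ * (Matrix.of T).transpose := by
    ext b b'
    have hbi : ∀ {u v : XWPoly n m}, IsBiform u 1 N → IsBiform v 1 N →
        IsBiform (normSqP ^ (d - 1) * 1 * u * v) (2 * d) (2 * N) := by
      intro u v hu hv
      have := ((IsBiform.normSqP.pow (d - 1)).mul hu).mul hv
      rw [mul_one]
      convert this using 1 <;> omega
    have h0 := hy _ ((hbi ((IsBiform.bMon b).mono h₁) ((IsBiform.bMon b').mono h₁)).sub
      (hbi ((IsBiform.of_mem_span (hp b)).mono h₂) ((IsBiform.of_mem_span (hp b')).mono h₂)))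
      (fun μ hμ => by simp only [map_sub, map_mul, hpv _ μ hμ, sub_self])
    rw [← rieszLin_apply, map_sub, sub_eq_zero, rieszLin_apply, rieszLin_apply, ← hT b, ← hT b',
      rieszL_sum_mul_sum] at h0
    change rieszL y _ = _
    rw [h0]
    simp only [Matrix.mul_apply, Matrix.transpose_apply, Matrix.of_apply, Finset.sum_mul]
    rw [Finset.sum_comm]
    refine Finset.sum_congr rfl fun c _ => Finset.sum_congr rfl fun c' _ => ?_
    simp only [hankel, locMatrix, Matrix.of_apply]
    ring
  rw [key]
  exact (Matrix.rank_mul_le_left _ _).trans (Matrix.rank_mul_le_right _ _)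

theorem exists_forall_rank_hankel_eq (hgen : IsGeneric A B C D)
    (hD : ‖Matrix.toEuclideanCLM (n := Fin m) (𝕜 := ℝ) D‖ < 1) :
    ∃ d₀ N₀ : ℕ, ∀ d ≥ d₀, ∀ N ≥ N₀, ∃ s : ℕ, 1 ≤ s ∧ s ≤ N ∧
      ∀ y, MomFeasible A B C D d N y →
        (hankel y d s).rank = (hankel y d (s - 1)).rank := by
  obtain ⟨r, hr⟩ := exists_isEigCurve hgen
  obtain ⟨d₀, N₀, hkey⟩ := exists_forall_eq_sum_mul_eqs hr hgen hD
  refine ⟨d₀ + 1, N₀ + (allEigs A B C D).card + 1, fun d hd N hN =>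
    ⟨(allEigs A B C D).card + 1, by omega, by omega, fun y hy => ?_⟩⟩
  have hvan : ∀ h : XWPoly n m, IsBiform h (2 * d) (2 * N) →
      (∀ μ ∈ allEigs A B C D, evalCurve r μ h = 0) → rieszL y h = 0 := by
    intro h hbi h0
    obtain ⟨p, q, hp, hq, rfl⟩ := hkey d (by omega) N (by omega) h hbi.1 hbi.2 h0
    rw [← rieszLin_apply, map_add, map_sum, map_sum]
    simp only [rieszLin_apply]
    rw [Finset.sum_eq_zero fun i _ => hy.eig_eq _ (hp i).1 (hp i).2 i,
      Finset.sum_eq_zero fun j _ => hy.relu_eq _ (hq j).1 (hq j).2 j, add_zero]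
  rw [Nat.add_sub_cancel]
  refine le_antisymm (rank_hankel_le (r := r) (by omega) hvan (by omega) (by omega) fun b => ?_)
    (rank_hankel_le (r := r) (by omega) hvan (by omega) (by omega) fun b => ?_)
  · exact hr.exists_mem_span_evalCurve_eq hgen (by omega) (fun μ => evalCurve r μ (bMon b))
      fun μ => evalCurve_conj r μ _
  · exact ⟨bMon b, Submodule.subset_span ⟨(b.1.castSucc, b.2), rfl⟩, fun _ _ => rfl⟩

end Interpolation

end

end SparseHierarchy

open SparseHierarchy
theorem mainTheorem4 (n m : ℕ)
    (A : Matrix (Fin n) (Fin n) ℝ) (B : Matrix (Fin n) (Fin m) ℝ)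
    (C : Matrix (Fin m) (Fin n) ℝ) (D : Matrix (Fin m) (Fin m) ℝ)
    (hD : ‖Matrix.toEuclideanCLM (n := Fin m) (𝕜 := ℝ) D‖ < 1)
    (hgen : IsGeneric A B C D)
    (f : XWPoly n m) (hf : IsXWHomogeneous f 2) :
    (∃ d₀ N₀ : ℕ, ∀ d ≥ d₀, ∀ N ≥ N₀,
      momValue A B C D f d N = minValue A B C D f ∧
      sosValue A B C D f d N = minValue A B C D f) ∧
    (∃ d₀ N₀ : ℕ, ∀ d ≥ d₀, ∀ N ≥ N₀, ∃ s : ℕ, 1 ≤ s ∧ s ≤ N ∧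
      ∀ y, MomFeasible A B C D d N y →
        (hankel y d s).rank = (hankel y d (s - 1)).rank) := by
  refine ⟨?_, exists_forall_rank_hankel_eq hgen hD⟩
  obtain ⟨d₀, N₀, h⟩ := exists_forall_sosFeasible hgen hD hf
  refine ⟨d₀ + 1, N₀, fun d hd N hN => ?_⟩
  have h1 := minValue_le_sosValue (h d (by omega) N hN)
  have h2 := sosValue_le_momValue (A := A) (B := B) (C := C) (D := D) f (d := d) (by omega) N
  have h3 := momValue_le_minValue (A := A) (B := B) (C := C) (D := D) f d N
  exact ⟨le_antisymm h3 (h1.trans h2), le_antisymm (h2.trans h3) h1⟩
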